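/- **Model.** A register holds a pair $(u\,|\,v)$ whose first half $u$ is a natural number, and supports the atomic operations: read(); write$(u'|v')$; half-max$(x)$, which replaces $u$ by $\max\{x,u\}$; and max-write$(x|y)$, which replaces $(u|v)$ by $(x|y)$ if $x\ge u$ and does nothing otherwise. Only read returns a value. Each of $n\ge 1$ asynchronous processes makes a sequence of function calls, one after the other; whenever a process is scheduled it executes one instruction (one register operation, one local computation, or a return) of its current call, or the first instruction of its next call. An execution is the sequence of instructions produced by a finite schedule. A compare-and-swap register with values in a set $X$ supports read(), which returns the current value, and compare-and-swap$(a,b)$, which sets the value to $b$ and returns true if the current value is $a$, and otherwise returns false without changing the value. **Algorithm.** Shared registers: $V=(\mathit{seq}\,|\,\mathit{val})$, $P=(\mathit{seq}\,|\,\mathit{pid},c)$, and $A[i]=(c\,|\,\mathit{val})$, $R[i]=(c\,|\,\mathit{ret})$ for each process $i$. Each process keeps a local counter $c$ between its calls. Initially $c=0$ for every process, $V=(0\,|\,x)$ with $x\in X$ the initial value of the object, and $P.\mathit{seq}=0$; the remaining initial contents are arbitrary. Process $\mathit{id}$ executes: - read(): $(\_\,|\,\mathit{val})\leftarrow V.$read();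 return $\mathit{val}$. - compare-and-swap$(a,b)$: 1. $(\mathit{seq}\,|\,\mathit{val})\leftarrow V.$read(); 2. if $a\ne \mathit{val}$, return false; 3. if $a=b$, return true; 4. $c\leftarrow c+1$; 5. $A[\mathit{id}].$write$(c\,|\,b)$; 6. $R[\mathit{id}].$write$(c\,|\,\text{false})$; 7. $P.$max-write$(\mathit{seq}+1\,|\,\mathit{id},c)$; 8. $P.$half-max$(\mathit{seq}+2)$; 9. $(\mathit{seq}\,|\,\mathit{pid},\mathit{cp})\leftarrow P.$read(); 10. $(\mathit{ca}\,|\,\mathit{val})\leftarrow A[\mathit{pid}].$read(); 11. if $\mathit{seq}$ is even and $\mathit{cp}=\mathit{ca}$, then $R[\mathit{pid}].$max-write$(\mathit{ca}\,|\,\text{true})$ and then $V.$max-write$(\mathit{seq}\,|\,\mathit{val})$; 12. $(\_\,|\,\mathit{ret})\leftarrow R[\mathit{id}].$read(); return $\mathit{ret}$. **Theorem.** This algorithm is a wait-free and linearizable implementation of a compare-and-swap register shared by $n$ processes, it uses $O(n)$ registers, and both functions take $O(1)$ steps. That is, there are absolute constants $K$ and $C$ such that for every set $X$, every $n\ge1$,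 every $x\in X$ and all initial contents as above, whatever functions the processes call: - (wait-free) for every call begun in an execution there is a number $N$ such that the call has returned once the calling process has taken $N$ further steps, irrespective of the schedule; - (linearizable) for every execution there is a total order of the calls appearing in it (finished and unfinished) that places a call $A$ ahead of a call $B$ whenever $A$ has returned and the last register operation of $A$ precedes the first register operation of $B$, and such that every finished call returned the value that the compare-and-swap register with initial value $x$ returns for it when all the calls are applied in this order; - every call, of read or of compare-and-swap, takes at most $K$ steps (instructions of any kind) in every execution; - the number of registers is at most $C\,n$. -/

import Mathlib

/-! ### Sequential objects and registers -/

/-- A sequential object: states, operations, return values and a transition function. -/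
structure SeqObject where
  State : Type
  Op : Type
  Ret : Type
  T : State → Op → State × Ret

/-- The return values obtained by applying a list of operations one after the other,
starting in state `s`. -/
def SeqObject.rets (obj : SeqObject) : obj.State → List obj.Op → List obj.Ret
  | _, [] => []
  | s, o :: os => (obj.T s o).2 :: obj.rets (obj.T s o).1 os

/-- The operations of a register. A register holds a pair: its first half is a natural number
and its second half is an element of `β`. -/
inductive RegOp (β : Type) : Type
  | read : RegOp β
  | write (v : ℕ × β) : RegOp β
  | halfMax (x : ℕ) : RegOp β
  | maxWrite (x : ℕ) (y : β) : RegOp β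

/-- What a register operation returns: only `read` returns something. -/
@[reducible] def RegOp.Ret {β : Type} : RegOp β → Type
  | .read => ℕ × β
  | .write _ => Unit
  | .halfMax _ => Unit
  | .maxWrite _ _ => Unit

/-- The (atomic) effect of a register operation: the new content and the returned value. -/
def RegOp.apply {β : Type} : (o : RegOp β) → ℕ × β → (ℕ × β) × o.Ret
  | .read, s => (s, s)
  | .write v, _ => (v, ())
  | .halfMax x, s => ((max x s.1, s.2), ())
  | .maxWrite x y, s => (if s.1 ≤ x then (x, y) else s, ())

/-! ### Implementations from registers, and their executions -/

/-- An instruction is one operation on one register (followed by a continuation that may depend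
on the returned value), a computation on local variables, or the return from the function
(which gives the returned value and the local variables that survive the call). -/
inductive Instr (Reg : Type) (Half : Reg → Type) (Ctl Vars Ret : Type) : Type
  | regOp (r : Reg) (o : RegOp (Half r)) (k : o.Ret → Ctl)
  | compute (k : Ctl)
  | ret (v : Ret) (vars : Vars)

/-- A program for `n` processes that implements, from registers, operations `Op` with
return values `Ret` of an object with states `State`. -/
structure Implementation (n : ℕ) (State Op Ret : Type) where
  /-- the shared registers -/
  Reg : Type
  [decReg : DecidableEq Reg]
  /-- the type of the second half of each register -/
  Half : Reg → Type
  /-- local variables of a process that are kept between its calls -/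
  Vars : Type
  /-- control points inside a function, with the values of the local variables -/
  Ctl : Type
  /-- the point at which the function for a given operation begins -/
  entry : Op → Vars → Ctl
  /-- the instruction that process `id` executes at a control point -/
  instr : (id : Fin n) → Ctl → Instr Reg Half Ctl Vars Ret
  /-- initial values of the local variables -/
  initVars : Vars
  /-- admissible initial contents of the registers, given the initial state of the object -/
  IsInit : State → ((r : Reg) → ℕ × Half r) → Prop

attribute [instance] Implementation.decReg

/-- The call `(p, k)` is the `k`-th call (counted from `0`) made by process `p`. -/
abbrev CallId (n : ℕ) : Type := Fin n × ℕ

/-- The kinds of instructions that appear in an execution. -/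
inductive StepKind (Ret : Type) : Type
  | regOp
  | compute
  | ret (v : Ret)

/-- One executed instruction: the call to which it belongs and its kind. -/
structure Event (n : ℕ) (Ret : Type) where
  call : CallId n
  kind : StepKind Ret

namespace Implementation

variable {n : ℕ} {State Op Ret : Type} (I : Implementation n State Op Ret)

/-- Contents of all registers. -/
abbrev Memory : Type := (r : I.Reg) → ℕ × I.Half r

/-- A global configuration. -/
structure Config where
  mem : I.Memory
  vars : Fin n → I.Vars
  /-- where the process is in its running call; `none` if it has no running call -/
  ctl : Fin n → Option I.Ctl
  /-- the number of calls from which the process has returned -/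
  done : Fin n → ℕ

/-- The initial configuration with register contents `m`. -/
def initial (m : I.Memory) : I.Config :=
  ⟨m, fun _ => I.initVars, fun _ => none, fun _ => 0⟩

/-- Process `p` executes its next instruction. The operation of the call `(p, k)` is `w p k`;
a process without a running call executes the first instruction of its next call. -/
def step (w : Fin n → ℕ → Op) (C : I.Config) (p : Fin n) : I.Config × Event n Ret :=
  match I.instr p ((C.ctl p).getD (I.entry (w p (C.done p)) (C.vars p))) with
  | .regOp r o k =>
      ({ C with
          mem := Function.update C.mem r (o.apply (C.mem r)).1
          ctl := Function.update C.ctl p (some (k (o.apply (C.mem r)).2)) },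
        ⟨(p, C.done p), .regOp⟩)
  | .compute k =>
      ({ C with ctl := Function.update C.ctl p (some k) }, ⟨(p, C.done p), .compute⟩)
  | .ret v vars =>
      ({ C with
          vars := Function.update C.vars p vars
          ctl := Function.update C.ctl p none
          done := Function.update C.done p (C.done p + 1) },
        ⟨(p, C.done p), .ret v⟩)

/-- The sequence of instructions executed from `C` under a schedule. -/
def exec (w : Fin n → ℕ → Op) : I.Config → List (Fin n) → List (Event n Ret)
  | _, [] => []
  | C, p :: σ => (I.step w C p).2 :: exec w (I.step w C p).1 σ

end Implementation

section Execution

variable {n : ℕ} {Ret : Type}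

/-- The call `c` has executed at least one instruction in `E`. -/
def Appears (E : List (Event n Ret)) (c : CallId n) : Prop := ∃ e ∈ E, e.call = c

/-- The call `c` returns `v` in `E`. -/
def Returns (E : List (Event n Ret)) (c : CallId n) (v : Ret) : Prop := ⟨c, .ret v⟩ ∈ E

/-- The `i`-th instruction of `E` is a register operation of the call `c`. -/
def RegOpAt (E : List (Event n Ret)) (c : CallId n) (i : ℕ) : Prop :=
  E[i]? = some ⟨c, .regOp⟩

/-- The call `c` starts at `i`: its first register operation is there. -/
def IsStart (E : List (Event n Ret)) (c : CallId n) (i : ℕ) : Prop :=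
  RegOpAt E c i ∧ ∀ j, RegOpAt E c j → i ≤ j

/-- The call `c` is finished and ends at `i`: its last register operation is there. -/
def IsEnd (E : List (Event n Ret)) (c : CallId n) (i : ℕ) : Prop :=
  (∃ v, Returns E c v) ∧ RegOpAt E c i ∧ ∀ j, RegOpAt E c j → j ≤ i

/-- The call `A` occurs before the call `B`: `A` ends before `B` starts. -/
def Before (E : List (Event n Ret)) (A B : CallId n) : Prop :=
  ∃ i j, IsEnd E A i ∧ IsStart E B j ∧ i < j

/-- The number of steps (instructions of any kind) that the call `c` takes in `E`. -/
def stepsOf (E : List (Event n Ret)) (c : CallId n) : ℕ := E.countP (fun e => e.call = c)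

end Execution

/-- The list `L` is a total order of the calls in the execution `E` (finished and unfinished)
that extends the order `Before E`, such that every finished call returns in `E` what the
sequential object, started in state `x`, returns for it when the calls are applied in the
order `L`. -/
def IsLinearization {n : ℕ} (obj : SeqObject) (x : obj.State) (w : Fin n → ℕ → obj.Op)
    (E : List (Event n obj.Ret)) (L : List (CallId n)) : Prop :=
  L.Nodup ∧
  (∀ c, c ∈ L ↔ Appears E c) ∧
  L.Pairwise (fun A B => ¬ Before E B A) ∧
  ∀ (i : ℕ) (c : CallId n) (v : obj.Ret), L[i]? = some c → Returns E c v →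
    (obj.rets x (L.map fun c => w c.1 c.2))[i]? = some v

namespace Implementation

variable {n : ℕ}

/-- Every execution has a linearization, whatever the processes call, whatever the schedule. -/
def Linearizable (obj : SeqObject) (I : Implementation n obj.State obj.Op obj.Ret) : Prop :=
  ∀ (x : obj.State) (m : I.Memory), I.IsInit x m →
    ∀ (w : Fin n → ℕ → obj.Op) (σ : List (Fin n)),
      ∃ L, IsLinearization obj x w (I.exec w (I.initial m) σ) L

/-- Every call returns within a finite number `N` of further steps of the calling process,
irrespective of how the processes are scheduled. -/
def WaitFree {State Op Ret : Type} (I : Implementation n State Op Ret) : Prop :=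
  ∀ (x : State) (m : I.Memory), I.IsInit x m →
    ∀ (w : Fin n → ℕ → Op) (σ : List (Fin n)) (c : CallId n),
      Appears (I.exec w (I.initial m) σ) c →
      ∃ N : ℕ, ∀ τ : List (Fin n), N ≤ τ.count c.1 →
        ∃ v, Returns (I.exec w (I.initial m) (σ ++ τ)) c v

/-- No call ever takes more than `K` steps. -/
def StepBound {State Op Ret : Type} (I : Implementation n State Op Ret) (K : ℕ) : Prop :=
  ∀ (x : State) (m : I.Memory), I.IsInit x m →
    ∀ (w : Fin n → ℕ → Op) (σ : List (Fin n)) (c : CallId n),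
      stepsOf (I.exec w (I.initial m) σ) c ≤ K

end Implementation

/-! ### The compare-and-swap register -/

inductive CASOp (Val : Type) : Type
  | read
  | cas (a b : Val)

inductive CASRet (Val : Type) : Type
  | val (v : Val)
  | bool (r : Bool)

/-- The compare-and-swap register with values in `Val`. -/
@[reducible] def casObject (Val : Type) [DecidableEq Val] : SeqObject where
  State := Val
  Op := CASOp Val
  Ret := CASRet Val
  T s
    | .read => (s, .val s)
    | .cas a b => if s = a then (b, .bool true) else (s, .bool false)

/-! ### The algorithm -/

/-- The shared registers: `V = (seq | val)`, `P = (seq | pid | c)`, `A[i] = (c | val)` and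
`R[i] = (c | ret)`. -/
inductive CASReg (n : ℕ) : Type
  | V
  | P
  | A (i : Fin n)
  | R (i : Fin n)
  deriving DecidableEq

/-- The second half of each register. -/
@[reducible] def CASReg.Half (n : ℕ) (Val : Type) : CASReg n → Type
  | .V => Val
  | .P => Fin n × ℕ
  | .A _ => Val
  | .R _ => Bool

/-- The lines of the two functions, each with the local variables that are still needed.
The variable `c` is the counter that a process keeps between its calls. -/
inductive CASLine (n : ℕ) (Val : Type) : Type
  | readV (c : ℕ)
  | readRet (c : ℕ) (val : Val)
  | rdval (c : ℕ) (a b : Val)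
  | neq (c : ℕ) (a b : Val) (seq : ℕ) (val : Val)
  | neqRet (c : ℕ)
  | eqeq (c : ℕ) (a b : Val) (seq : ℕ)
  | eqeqRet (c : ℕ)
  | count (c : ℕ) (b : Val) (seq : ℕ)
  | ann (c : ℕ) (b : Val) (seq : ℕ)
  | init (c : ℕ) (seq : ℕ)
  | comp (c : ℕ) (seq : ℕ)
  | win (c : ℕ) (seq : ℕ)
  | prd (c : ℕ)
  | ard (c : ℕ) (seq : ℕ) (pid : Fin n) (cp : ℕ)
  | chk (c : ℕ) (seq : ℕ) (pid : Fin n) (cp : ℕ) (ca : ℕ) (val : Val)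
  | inf (c : ℕ) (seq : ℕ) (pid : Fin n) (ca : ℕ) (val : Val)
  | update (c : ℕ) (seq : ℕ) (val : Val)
  | retRead (c : ℕ)
  | retEnd (c : ℕ) (ret : Bool)

/-- The program text, for the process `id`. -/
def casInstr (n : ℕ) (Val : Type) [DecidableEq Val] (id : Fin n) :
    CASLine n Val → Instr (CASReg n) (CASReg.Half n Val) (CASLine n Val) ℕ (CASRet Val)
  -- `read()`: `(_ | val) ← V.read()`; return `val`
  | .readV c => .regOp .V .read fun r => .readRet c r.2
  | .readRet c val => .ret (.val val) c
  -- `compare-and-swap(a, b)`: `(seq | val) ← V.read()`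
  | .rdval c a b => .regOp .V .read fun r => .neq c a b r.1 r.2
  -- if `a ≠ val` then return false
  | .neq c a b seq val => .compute (if a ≠ val then .neqRet c else .eqeq c a b seq)
  | .neqRet c => .ret (.bool false) c
  -- if `a = b` then return true
  | .eqeq c a b seq => .compute (if a = b then .eqeqRet c else .count c b seq)
  | .eqeqRet c => .ret (.bool true) c
  -- `c ← c + 1`
  | .count c b seq => .compute (.ann (c + 1) b seq)
  -- `A[id].write(c | b)`
  | .ann c b seq => .regOp (.A id) (.write (c, b)) fun _ => .init c seq
  -- `R[id].write(c | false)`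
  | .init c seq => .regOp (.R id) (.write (c, false)) fun _ => .comp c seq
  -- `P.max-write(seq + 1 | id | c)`
  | .comp c seq => .regOp .P (.maxWrite (seq + 1) (id, c)) fun _ => .win c seq
  -- `P.half-max(seq + 2)`
  | .win c seq => .regOp .P (.halfMax (seq + 2)) fun _ => .prd c
  -- `(seq | pid | cp) ← P.read()`
  | .prd c => .regOp .P .read fun r => .ard c r.1 r.2.1 r.2.2
  -- `(ca | val) ← A[pid].read()`
  | .ard c seq pid cp => .regOp (.A pid) .read fun r => .chk c seq pid cp r.1 r.2
  -- if `seq` is even and `cp = ca` then execute the next two lines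
  | .chk c seq pid cp ca val =>
      .compute (if Even seq ∧ cp = ca then .inf c seq pid ca val else .retRead c)
  -- `R[pid].max-write(ca | true)`
  | .inf c seq pid ca val => .regOp (.R pid) (.maxWrite ca true) fun _ => .update c seq val
  -- `V.max-write(seq | val)`
  | .update c seq val => .regOp .V (.maxWrite seq val) fun _ => .retRead c
  -- `(_ | ret) ← R[id].read()`; return `ret`
  | .retRead c => .regOp (.R id) .read fun r => .retEnd c r.2
  | .retEnd c ret => .ret (.bool ret) c

/-- The algorithm. Initially `c = 0`, `V = (0 | x)` with `x` the initial value of the object, and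
`P.seq = 0`; all other initial register contents are arbitrary. -/
@[reducible] def casAlgorithm (n : ℕ) (Val : Type) [DecidableEq Val] :
    Implementation n (casObject Val).State (casObject Val).Op (casObject Val).Ret where
  Reg := CASReg n
  Half := CASReg.Half n Val
  Vars := ℕ
  Ctl := CASLine n Val
  entry
    | .read, c => .readV c
    | .cas a b, c => .rdval c a b
  instr := casInstr n Val
  initVars := 0
  IsInit x m := m .V = (0, x) ∧ (m .P).1 = 0

/-! ### The invariant of the algorithm -/

/-! Every finished call gets an instruction at which it takes effect, and the order of these
instructions is the linearization. A read takes effect at its read of `V`, and so does a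
compare-and-swap that this read decides (`a ≠ val`, or `a = b = val`). Every other compare-and-swap
stays undecided until `V.seq` is next raised, which always happens by two. That single instruction
decides all undecided calls past their read of `V` (`settle`): first the call named in `P`, which
succeeds, then the others, which fail. This is legal because all of them expect the current value,
and the winner has `a ≠ b` and so replaces it by a different one (`TakesEffect.settle`).

That the algorithm returns these values is the content of `CASInv`. Between two changes of `V`,
`P.seq` moves from `V.seq` through `V.seq + 1`, where the leader may still be replaced, to `V.seq +
2`, where the leader is fixed. The flag in `R` of the leader is set before `V` is raised, and no
other undecided call has a true flag, so at the change of `V` each flag of an announced call already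
is its result. An undecided call cannot miss the change: it closes the competition, reads `V.seq +
2` from `P`, finds the leader's announcement in `A`, and finally raises `V` itself if nobody has
done so.

A helper either still sees the current leader or is late; these are the two alternatives in `SawP`
and `SawA`. Late helpers do no harm: the counters make a late write to `R` either refused or a
repetition of a true flag (`Informed`), and a late max-write on `V` is refused or rewrites its
present content.

For the real-time order, a call decided by another process is at an `IsLate` line: it has begun, and
it executes a further register operation before it returns. Hence each effect lies between the first
and last register operations of its call, and `isLinearization_of_effects` applies to the history
kept in `HistoryInv`. The bounds on steps are independent of this: the program has no loops, which
`IsRank` expresses by a rank increasing along every call. -/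

/-- The register contents, split into their components. -/
structure Shared (n : ℕ) (Val : Type) where
  vseq : ℕ
  vval : Val
  pseq : ℕ
  ppid : Fin n
  pctr : ℕ
  actr : Fin n → ℕ
  aval : Fin n → Val
  rctr : Fin n → ℕ
  rret : Fin n → Bool

/-- The components of the register contents `m`. -/
def Shared.ofMemory {n : ℕ} {Val : Type} (m : (r : CASReg n) → ℕ × CASReg.Half n Val r) :
    Shared n Val where
  vseq := (m .V).1
  vval := (m .V).2
  pseq := (m .P).1
  ppid := (m .P).2.1
  pctr := (m .P).2.2
  actr i := (m (.A i)).1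
  aval i := (m (.A i)).2
  rctr i := (m (.R i)).1
  rret i := (m (.R i)).2

/-! ### Classification of the program lines -/

namespace CASLine

variable {n : ℕ} {Val : Type}

/-- The counter with which the process has last initialised its register `R`. -/
def initCtr : CASLine n Val → ℕ
  | readV c => c
  | readRet c _ => c
  | rdval c _ _ => c
  | neq c _ _ _ _ => c
  | neqRet c => c
  | eqeq c _ _ _ => c
  | eqeqRet c => c
  | count c _ _ => c
  -- At this line and the next, the counter has been raised but `R` still belongs to the previous
  -- value.
  | ann c _ _ => c - 1
  | init c _ => c - 1
  | comp c _ => c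
  | win c _ => c
  | prd c => c
  | ard c _ _ _ => c
  | chk c _ _ _ _ _ => c
  | inf c _ _ _ _ => c
  | update c _ _ => c
  | retRead c => c
  | retEnd c _ => c

/-- The lines from the competition for `P` up to the update of `V`, with the counter. -/
def posted : CASLine n Val → Option ℕ
  | win c _ => some c
  | prd c => some c
  | ard c _ _ _ => some c
  | chk c _ _ _ _ _ => some c
  | inf c _ _ _ _ => some c
  | update c _ _ => some c
  | _ => none

/-- The first line of a function. -/
def IsEntry : CASLine n Val → Prop
  | readV _ => True
  | rdval _ _ _ => True
  | _ => False

/-- The lines at which a compare-and-swap may take effect, or may have taken effect, by a step of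
another process, and after which it executes at least one more register operation. -/
def IsLate : CASLine n Val → Prop
  | readV _ => False
  | readRet _ _ => False
  | rdval _ _ _ => False
  | neq _ a b _ val => a = val ∧ a ≠ b
  | neqRet _ => False
  | eqeq _ a b _ => a ≠ b
  | eqeqRet _ => False
  | retEnd _ _ => False
  | _ => True

end CASLine

/-! ### The assertions that make up the invariant -/

section Invariant

variable {n : ℕ} {Val : Type}

/-- The call of process `q` with counter `k` has won, and the register `R` of `q` says so as long as
`q` has not initialised it for a later call; `ic` gives the counter of the last initialisation. -/
def Informed (S : Shared n Val) (ic : Fin n → ℕ) (q : Fin n) (k : ℕ) : Prop :=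
  1 ≤ k ∧ k ≤ ic q ∧ (k = ic q → S.rctr q = k ∧ S.rret q = true)

/-- What holds of a compare-and-swap that has read `a` from `V` with sequence number `seq` and has
not yet announced itself to the others; `r` is its return value if it has taken effect. -/
def Pending (S : Shared n Val) (a : Val) (seq : ℕ) (r : Option (CASRet Val)) : Prop :=
  Even seq ∧ (r = none → seq = S.vseq ∧ a = S.vval) ∧
    ∀ v, r = some v → v = .bool false ∧ seq + 2 ≤ S.vseq

/-- What holds of the compare-and-swap `op` of process `p` with counter `c` once it has initialised
the registers `A` and `R` of `p`. -/
def Announced (S : Shared n Val) (p : Fin n) (op : CASOp Val) (r : Option (CASRet Val)) (c : ℕ) :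
    Prop :=
  1 ≤ c ∧ ∃ a b, op = .cas a b ∧ a ≠ b ∧ S.actr p = c ∧ S.aval p = b ∧ S.rctr p = c ∧
    (r = none → a = S.vval ∧
      (S.rret p = true → S.pseq = S.vseq + 2 ∧ S.ppid = p ∧ S.pctr = c)) ∧
    ∀ v, r = some v → v = .bool (S.rret p)

/-- The pair `pid, cp` has been read from `P` with sequence number `q`. -/
def SawP (S : Shared n Val) (ic : Fin n → ℕ) (q : ℕ) (pid : Fin n) (cp : ℕ) : Prop :=
  (q ≤ S.vseq ∧ Informed S ic pid cp ∧ (q = S.vseq → S.actr pid = cp → S.aval pid = S.vval)) ∨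
    (q = S.vseq + 2 ∧ S.pseq = q ∧ S.ppid = pid ∧ S.pctr = cp)

/-- The pair `pid, ca` has been read from `P` with sequence number `q`, and `val` from the matching
content of `A pid`. -/
def SawA (S : Shared n Val) (ic : Fin n → ℕ) (q : ℕ) (pid : Fin n) (ca : ℕ) (val : Val) : Prop :=
  (q ≤ S.vseq ∧ Informed S ic pid ca ∧ (q = S.vseq → val = S.vval)) ∨
    (q = S.vseq + 2 ∧ S.pseq = q ∧ S.ppid = pid ∧ S.pctr = ca ∧ S.actr pid = ca ∧
      S.aval pid = val)

/-- What holds of process `p` at each line, where `op` is the operation of its current call and `r`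
the return value if the call has taken effect. -/
def LineInv (S : Shared n Val) (ic : Fin n → ℕ) (p : Fin n) (op : CASOp Val)
    (r : Option (CASRet Val)) : CASLine n Val → Prop
  | .readV _ => op = .read ∧ r = none
  | .readRet _ v => r = some (.val v)
  | .rdval _ a b => op = .cas a b ∧ r = none
  | .neq _ a b seq val => op = .cas a b ∧ (a ≠ val → r = some (.bool false)) ∧
      (a = val → a = b → r = some (.bool true)) ∧ (a = val → a ≠ b → Pending S a seq r)
  | .neqRet _ => r = some (.bool false)
  | .eqeq _ a b seq => op = .cas a b ∧ (a = b → r = some (.bool true)) ∧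
      (a ≠ b → Pending S a seq r)
  | .eqeqRet _ => r = some (.bool true)
  | .count _ b seq => ∃ a, op = .cas a b ∧ a ≠ b ∧ Pending S a seq r
  | .ann c b seq => 1 ≤ c ∧ ∃ a, op = .cas a b ∧ a ≠ b ∧ Pending S a seq r
  | .init c seq => 1 ≤ c ∧ ∃ a b, op = .cas a b ∧ a ≠ b ∧ Pending S a seq r ∧
      S.actr p = c ∧ S.aval p = b
  | .comp c seq => Announced S p op r c ∧ Even seq ∧ (r = none → seq = S.vseq) ∧
      (r ≠ none → seq + 2 ≤ S.vseq)
  | .win c seq => Announced S p op r c ∧ Even seq ∧ (r = none → seq = S.vseq ∧ seq + 1 ≤ S.pseq) ∧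
      (r ≠ none → seq + 2 ≤ S.vseq)
  | .prd c => Announced S p op r c ∧ 2 ≤ S.pseq ∧ (r = none → S.pseq = S.vseq + 2)
  | .ard c q pid cp => Announced S p op r c ∧ (Even q → SawP S ic q pid cp) ∧
      (r = none → q = S.vseq + 2)
  | .chk c q pid cp ca val => Announced S p op r c ∧ (Even q → cp = ca → SawA S ic q pid ca val) ∧
      (r = none → q = S.vseq + 2 ∧ cp = ca)
  | .inf c q pid ca val => Announced S p op r c ∧ Even q ∧ SawA S ic q pid ca val ∧
      (r = none → q = S.vseq + 2)
  | .update c q val => Announced S p op r c ∧ Even q ∧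
      ((q ≤ S.vseq ∧ (q = S.vseq → val = S.vval)) ∨
        (q = S.vseq + 2 ∧ S.pseq = q ∧ S.actr S.ppid = S.pctr ∧ S.aval S.ppid = val ∧
          S.rctr S.ppid = S.pctr ∧ S.rret S.ppid = true)) ∧
      (r = none → q = S.vseq + 2)
  | .retRead _ => r = some (.bool (S.rret p))
  | .retEnd _ ret => r = some (.bool ret)

/-- The invariant of the algorithm: `cur p` is the line at which process `p` is (the first line of
its next call if none is running), `op p` the operation of its call, and `st p` the return value of
that call if it has taken effect. -/
structure CASInv (S : Shared n Val) (cur : Fin n → CASLine n Val) (op : Fin n → CASOp Val)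
    (st : Fin n → Option (CASRet Val)) : Prop where
  even : Even S.vseq
  le_pseq : S.vseq ≤ S.pseq
  pseq_le : S.pseq ≤ S.vseq + 2
  settled : S.pseq = S.vseq → S.vseq ≠ 0 → Informed S (fun q => (cur q).initCtr) S.ppid S.pctr ∧
    (S.actr S.ppid = S.pctr → S.aval S.ppid = S.vval)
  leader : S.vseq < S.pseq → (cur S.ppid).posted = some S.pctr ∧ st S.ppid = none
  rctr_eq : ∀ q, 1 ≤ (cur q).initCtr → S.rctr q = (cur q).initCtr
  line : ∀ q, LineInv S (fun q => (cur q).initCtr) q (op q) (st q) (cur q)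

/-! ### Preservation by the steps that leave `V` unchanged -/

/-- A posted call that has not taken effect is announced. -/
theorem LineInv.announced {S : Shared n Val} {ic : Fin n → ℕ} {p : Fin n} {op : CASOp Val}
    {r : Option (CASRet Val)} {l : CASLine n Val} {c : ℕ} (h : LineInv S ic p op r l)
    (hl : l.posted = some c) : Announced S p op r c := by
  cases l <;> simp_all [CASLine.posted, LineInv]

/-- The processes other than the one that takes a step keep their invariant, if the step does not
change `V` and preserves the parts of the invariant. -/
theorem LineInv.of_imp {S S' : Shared n Val} {ic ic' : Fin n → ℕ} {p : Fin n} {op : CASOp Val}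
    {r : Option (CASRet Val)} {l : CASLine n Val} (h : LineInv S ic p op r l)
    (hseq : S'.vseq = S.vseq) (hval : S'.vval = S.vval)
    (hann : ∀ c, Announced S p op r c → Announced S' p op r c)
    (hsp : ∀ q pid cp, SawP S ic q pid cp → SawP S' ic' q pid cp)
    (hsa : ∀ q pid ca val, SawA S ic q pid ca val → SawA S' ic' q pid ca val)
    (hps : S.pseq ≤ S'.pseq) (hps' : S.pseq = S.vseq + 2 → S'.pseq = S.vseq + 2)
    (hactr : S'.actr p = S.actr p) (haval : S'.aval p = S.aval p)
    (hret : r = some (.bool (S.rret p)) → r = some (.bool (S'.rret p)))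
    (hupd : ∀ val, S.pseq = S.vseq + 2 → S.actr S.ppid = S.pctr → S.aval S.ppid = val →
      S.rctr S.ppid = S.pctr → S.rret S.ppid = true → S'.actr S'.ppid = S'.pctr ∧
        S'.aval S'.ppid = val ∧ S'.rctr S'.ppid = S'.pctr ∧ S'.rret S'.ppid = true) :
    LineInv S' ic' p op r l := by
  cases l <;> simp only [LineInv, Pending, hseq, hval, hactr, haval] at h ⊢
  case comp => exact ⟨hann _ h.1, h.2⟩
  case win => exact ⟨hann _ h.1, h.2.1, fun hr => ⟨(h.2.2.1 hr).1, (h.2.2.1 hr).2.trans hps⟩, h.2.2.2⟩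
  case prd => exact ⟨hann _ h.1, h.2.1.trans hps, fun hr => hps' (h.2.2 hr)⟩
  case ard => exact ⟨hann _ h.1, fun he => hsp _ _ _ (h.2.1 he), h.2.2⟩
  case chk => exact ⟨hann _ h.1, fun he hc => hsa _ _ _ _ (h.2.1 he hc), h.2.2⟩
  case inf => exact ⟨hann _ h.1, h.2.1, hsa _ _ _ _ h.2.2.1, h.2.2.2⟩
  case update =>
    refine ⟨hann _ h.1, h.2.1, ?_, h.2.2.2⟩
    rcases h.2.2.1 with h' | ⟨h1, h2, h3, h4, h5, h6⟩
    · exact .inl h'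
    · exact .inr ⟨h1, by rw [hps' (h2.trans h1), h1], hupd _ (h2.trans h1) h3 h4 h5 h6⟩
  case retRead => exact hret h
  all_goals exact h

/-- `Informed`, `SawP` and `SawA` see the lines of the processes only through these counters, so
steps that keep them need no new argument there. -/
theorem initCtr_update {cur : Fin n → CASLine n Val} {p : Fin n} {l : CASLine n Val}
    (hc : l.initCtr = (cur p).initCtr) :
    (fun q => (Function.update cur p l q).initCtr) = fun q => (cur q).initCtr := by
  funext q
  by_cases hq : q = p
  · subst hq; simpa using hc
  · simp [hq]

/-- A step without effect on the registers. -/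
theorem CASInv.local_step {S : Shared n Val} {cur : Fin n → CASLine n Val} {op : Fin n → CASOp Val}
    {st : Fin n → Option (CASRet Val)} (h : CASInv S cur op st) (p : Fin n) (l : CASLine n Val)
    (r : Option (CASRet Val)) (o : CASOp Val) (hc : l.initCtr = (cur p).initCtr)
    (hp : (cur p).posted ≠ none → st p = none → l.posted = (cur p).posted ∧ r = none)
    (hl : LineInv S (fun q => (cur q).initCtr) p o r l) :
    CASInv S (Function.update cur p l) (Function.update op p o) (Function.update st p r) := by
  have e := initCtr_update hc
  refine ⟨h.even, h.le_pseq, h.pseq_le, ?_, ?_, ?_, ?_⟩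
  · rw [e]; exact h.settled
  · intro hlt
    have := h.leader hlt
    by_cases hq : S.ppid = p
    · subst hq; simp; grind
    · simpa [hq] using this
  · intro q
    rw [congrFun e q]
    exact h.rctr_eq q
  · rw [e]
    intro q
    by_cases hq : q = p
    · subst hq; simpa using hl
    · simpa [hq] using h.line q

/-- Process `p` announces its new value. -/
theorem CASInv.ann_step {S : Shared n Val} {cur : Fin n → CASLine n Val} {op : Fin n → CASOp Val}
    {st : Fin n → Option (CASRet Val)} (h : CASInv S cur op st) {p : Fin n} {c seq : ℕ} {b : Val}
    (hp : cur p = .ann c b seq) :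
    CASInv { S with actr := Function.update S.actr p c, aval := Function.update S.aval p b }
      (Function.update cur p (.init c seq)) op st := by
  have e := initCtr_update (cur := cur) (p := p) (l := .init c seq) (by simp [hp, CASLine.initCtr])
  have hlp := h.line p
  have hpc : (cur p).initCtr = c - 1 := by simp [hp, CASLine.initCtr]
  rw [hp] at hlp
  simp only [LineInv] at hlp
  -- Informed counters of `p` are at most `c - 1`, so the new content of `A p` never matches a pair
  -- that has already won.
  have hinf : ∀ q k, Informed S (fun q => (cur q).initCtr) q k → ¬ (q = p ∧ k = c) := by
    simp only [Informed]
    grind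
  -- A leader is at a posted line, and `p` is not.
  have hne : S.vseq < S.pseq → S.ppid ≠ p := by
    intro hlt hh
    have := (h.leader hlt).1
    simp [hh, hp, CASLine.posted] at this
  refine ⟨h.even, h.le_pseq, h.pseq_le, ?_, ?_, ?_, ?_⟩
  · rw [e]
    intro h1 h2
    have h3 := h.settled h1 h2
    refine ⟨h3.1, ?_⟩
    have := hinf _ _ h3.1
    simp only [Function.update_apply]
    grind
  · intro hlt
    rw [Function.update_of_ne (hne hlt)]
    exact h.leader hlt
  · intro q
    rw [congrFun e q]
    exact h.rctr_eq q
  · rw [e]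
    intro q
    by_cases hq : q = p
    · subst hq
      simp only [LineInv, Function.update_self, Pending] at *
      grind
    · rw [Function.update_of_ne hq]
      refine (h.line q).of_imp rfl rfl ?_ ?_ ?_ le_rfl id (by simp [hq]) (by simp [hq]) id ?_
      · intro c
        simp [Announced, hq]
      · rintro k pid cp (⟨h1, h2, h3⟩ | h1)
        · refine .inl ⟨h1, h2, fun h4 => ?_⟩
          have := hinf _ _ h2
          simp only [Function.update_apply]
          grind
        · exact .inr h1
      · rintro k pid cp val (h1 | h1)
        · exact .inl h1
        · have : pid ≠ p := by have := h1.2.2.1 ▸ hne; grind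
          exact .inr (by simpa [this] using h1)
      · intro val h1
        have := hne (by omega)
        simp only [Function.update_of_ne this]
        grind

/-- Process `p` initialises its register `R`. -/
theorem CASInv.init_step {S : Shared n Val} {cur : Fin n → CASLine n Val} {op : Fin n → CASOp Val}
    {st : Fin n → Option (CASRet Val)} (h : CASInv S cur op st) {p : Fin n} {c seq : ℕ}
    (hp : cur p = .init c seq) :
    CASInv { S with rctr := Function.update S.rctr p c, rret := Function.update S.rret p false }
      (Function.update cur p (.comp c seq)) op st := by
  have hlp := h.line p
  have hpc : (cur p).initCtr = c - 1 := by simp [hp, CASLine.initCtr]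
  rw [hp] at hlp
  simp only [LineInv] at hlp
  have e : ∀ q, (Function.update cur p (.comp c seq) q).initCtr =
      if q = p then c else (cur q).initCtr := by
    intro q
    by_cases hq : q = p
    · subst hq; simp [CASLine.initCtr]
    · simp [hq]
  -- Informed counters of `p` are now strictly below its last initialisation, so they no longer
  -- claim anything about `R p`.
  have hinf : ∀ q k, Informed S (fun q => (cur q).initCtr) q k →
      Informed { S with rctr := Function.update S.rctr p c, rret := Function.update S.rret p false }
        (fun q => if q = p then c else (cur q).initCtr) q k := by
    intro q k
    simp only [Informed, Function.update_apply]
    grind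
  have hne : S.vseq < S.pseq → S.ppid ≠ p := by
    intro hlt hh
    have := (h.leader hlt).1
    simp [hh, hp, CASLine.posted] at this
  refine ⟨h.even, h.le_pseq, h.pseq_le, ?_, ?_, ?_, ?_⟩
  · intro h1 h2
    simp only [e]
    have h3 := h.settled h1 h2
    exact ⟨hinf _ _ h3.1, h3.2⟩
  · intro hlt
    rw [Function.update_of_ne (hne hlt)]
    exact h.leader hlt
  · intro q
    have := h.rctr_eq q
    simp only [Function.update_apply]
    grind
  · simp only [e]
    intro q
    by_cases hq : q = p
    · subst hq
      obtain ⟨h1, a, b, h2, h3, h4, h5, h6⟩ := hlp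
      simp only [LineInv, Function.update_self, Pending, Announced] at *
      refine ⟨⟨h1, a, b, h2, h3, h5, h6, trivial, by grind, by grind⟩, h4.1, by grind, fun hr => ?_⟩
      obtain ⟨v, hv⟩ := Option.ne_none_iff_exists'.1 hr
      exact (h4.2.2 v hv).2
    · rw [Function.update_of_ne hq]
      refine (h.line q).of_imp rfl rfl ?_ ?_ ?_ le_rfl id rfl rfl (by simp [hq]) ?_
      · intro c
        simp [Announced, hq]
      · rintro k pid cp (⟨h1, h2, h3⟩ | h1)
        · exact .inl ⟨h1, hinf _ _ h2, h3⟩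
        · exact .inr h1
      · rintro k pid cp val (⟨h1, h2, h3⟩ | h1)
        · exact .inl ⟨h1, hinf _ _ h2, h3⟩
        · exact .inr h1
      · intro val h1
        have := hne (by omega)
        simp only [Function.update_of_ne this]
        grind

/-- Process `p` competes for `P`. -/
theorem CASInv.comp_step {S : Shared n Val} {cur : Fin n → CASLine n Val} {op : Fin n → CASOp Val}
    {st : Fin n → Option (CASRet Val)} (h : CASInv S cur op st) {p : Fin n} {c seq : ℕ}
    (hp : cur p = .comp c seq) :
    CASInv (if S.pseq ≤ seq + 1 then { S with pseq := seq + 1, ppid := p, pctr := c } else S)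
      (Function.update cur p (.win c seq)) op st := by
  have hlp := h.line p
  have hev := h.even
  have hle := h.le_pseq
  have hle' := h.pseq_le
  rw [hp] at hlp
  obtain ⟨ha, hs, hn, hs'⟩ := hlp
  have e := initCtr_update (cur := cur) (p := p) (l := .win c seq) (by simp [hp, CASLine.initCtr])
  by_cases hlt : S.pseq ≤ seq + 1
  · have hst : st p = none := by grind
    have hseq := hn hst
    rw [if_pos hlt]
    refine ⟨h.even, by simp; omega, by simp; omega, by simp; omega, ?_, ?_, ?_⟩
    · intro
      simp [CASLine.posted, hst]
    · intro q
      rw [congrFun e q]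
      exact h.rctr_eq q
    · rw [e]
      intro q
      by_cases hq : q = p
      · subst hq
        simp only [LineInv, Function.update_self, Announced] at *
        grind
      · rw [Function.update_of_ne hq]
        -- Whatever the other calls assert about the leader presupposes `P.seq = V.seq + 2`. Here
        -- `P.seq ≤ V.seq + 1`, so replacing the leader contradicts none of it.
        refine (h.line q).of_imp rfl rfl ?_ ?_ ?_ hlt (by simp; omega) rfl rfl id ?_
        · rintro k ⟨h0, a, b, h1, h2, h3, h4, h5, h6, h7⟩
          refine ⟨h0, a, b, h1, h2, h3, h4, h5, fun hr => ⟨(h6 hr).1, fun hr' => ?_⟩, h7⟩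
          have := ((h6 hr).2 hr').1
          omega
        · rintro k pid cp (h1 | h1)
          · exact .inl h1
          · omega
        · rintro k pid cp val (h1 | h1)
          · exact .inl h1
          · omega
        · intros; omega
  · rw [if_neg hlt]
    have := h.local_step p (.win c seq) (st p) (op p) (by simp [hp, CASLine.initCtr])
      (by simp [hp, CASLine.posted]) ⟨ha, hs, fun hr => ⟨hn hr, by omega⟩, hs'⟩
    simpa using this

/-- Process `p` closes the competition. -/
theorem CASInv.win_step {S : Shared n Val} {cur : Fin n → CASLine n Val} {op : Fin n → CASOp Val}
    {st : Fin n → Option (CASRet Val)} (h : CASInv S cur op st) {p : Fin n} {c seq : ℕ}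
    (hp : cur p = .win c seq) :
    CASInv { S with pseq := max (seq + 2) S.pseq } (Function.update cur p (.prd c)) op st := by
  have hlp := h.line p
  have hev := h.even
  have hle := h.le_pseq
  have hle' := h.pseq_le
  rw [hp] at hlp
  obtain ⟨ha, hs, hn, hs'⟩ := hlp
  have e := initCtr_update (cur := cur) (p := p) (l := .prd c) (by simp [hp, CASLine.initCtr])
  -- The half-max closes an open competition or does nothing. It never acts on `P.seq = V.seq`: an
  -- undecided call has already secured `V.seq + 1 ≤ P.seq`, and a decided one has `seq + 2 ≤
  -- V.seq`.
  have hmax : max (seq + 2) S.pseq = S.pseq ∨ max (seq + 2) S.pseq = S.vseq + 2 ∧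
      S.pseq = S.vseq + 1 := by
    by_cases hst : st p = none
    · have := hn hst; omega
    · have := hs' hst; omega
  have hmax' : st p = none → max (seq + 2) S.pseq = S.vseq + 2 := by
    intro hst
    have := hn hst; omega
  have h2 : 2 ≤ max (seq + 2) S.pseq := by omega
  revert hmax hmax' h2
  generalize max (seq + 2) S.pseq = m
  intro hmax hmax' h2
  refine ⟨h.even, by simp; omega, by simp; omega, ?_, ?_, ?_, ?_⟩
  · rw [e]
    intro h3
    have h4 : S.pseq = S.vseq := by simp at h3; omega
    exact h.settled h4
  · intro h3
    have h4 : S.vseq < S.pseq := by simp at h3; omega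
    have := h.leader h4
    by_cases hq : S.ppid = p
    · simp_all [CASLine.posted]
    · simpa [hq] using this
  · intro q
    rw [congrFun e q]
    exact h.rctr_eq q
  · rw [e]
    have hA : ∀ q o r k, Announced S q o r k → Announced { S with pseq := m } q o r k := by
      rintro q o r k ⟨h0, a, b, h1, h2, h3, h4, h5, h6, h7⟩
      refine ⟨h0, a, b, h1, h2, h3, h4, h5, fun hr => ⟨(h6 hr).1, fun hr' => ?_⟩, h7⟩
      have := ((h6 hr).2 hr')
      exact ⟨by simp; omega, this.2⟩
    intro q
    by_cases hq : q = p
    · subst hq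
      rw [Function.update_self]
      exact ⟨hA _ _ _ _ ha, h2, hmax'⟩
    · rw [Function.update_of_ne hq]
      refine (h.line q).of_imp rfl rfl (hA _ _ _) ?_ ?_ (by simp; omega) (by simp; omega)
        rfl rfl id ?_
      · rintro k pid cp (h1 | h1)
        · exact .inl h1
        · exact .inr ⟨h1.1, by simp; omega, h1.2.2⟩
      · rintro k pid cp val (h1 | h1)
        · exact .inl h1
        · exact .inr ⟨h1.1, by simp; omega, h1.2.2⟩
      · intro val _ h1 h2 h3 h4
        exact ⟨h1, h2, h3, h4⟩

/-- Process `p` informs the winner. -/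
theorem CASInv.inf_step {S : Shared n Val} {cur : Fin n → CASLine n Val} {op : Fin n → CASOp Val}
    {st : Fin n → Option (CASRet Val)} (h : CASInv S cur op st) {p pid : Fin n} {c k ca : ℕ}
    {val : Val} (hp : cur p = .inf c k pid ca val) :
    CASInv (if S.rctr pid ≤ ca then
        { S with rctr := Function.update S.rctr pid ca, rret := Function.update S.rret pid true }
        else S)
      (Function.update cur p (.update c k val)) op st := by
  have hlp := h.line p
  rw [hp] at hlp
  obtain ⟨ha, hk, hs, hn⟩ := hlp
  have hcr : (CASLine.update c k val : CASLine n Val).initCtr = (cur p).initCtr := by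
    simp [hp, CASLine.initCtr]
  have e := initCtr_update (cur := cur) (p := p) (l := .update c k val) hcr
  -- For a late helper the max-write is refused or repeats a true flag. Otherwise the winner is the
  -- current leader, and its `R` carries exactly the counter `ca`, so only the flag changes.
  rcases hs with ⟨hk', hi, hv⟩ | ⟨hk', h1, h2, h3, h4, h5⟩
  · have hsame : (if S.rctr pid ≤ ca then
        { S with rctr := Function.update S.rctr pid ca, rret := Function.update S.rret pid true }
        else S) = S := by
      have h1 := h.rctr_eq pid
      obtain ⟨i1, i2, i3⟩ := hi
      split_ifs with hle
      · have h4 := i3 (by simp only at i2 ⊢; omega)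
        have e1 : Function.update S.rctr pid ca = S.rctr := by rw [← h4.1]; simp
        have e2 : Function.update S.rret pid true = S.rret := by rw [← h4.2]; simp
        rw [e1, e2]
      · rfl
    rw [hsame]
    have := h.local_step p (.update c k val) (st p) (op p) hcr
      (by simp [hp, CASLine.posted]) ⟨ha, hk, .inl ⟨hk', hv⟩, hn⟩
    simpa using this
  · subst h2
    have hlt : S.vseq < S.pseq := by omega
    obtain ⟨l1, l2⟩ := h.leader hlt
    have ha' := (h.line S.ppid).announced l1
    have hr : S.rctr S.ppid = ca := by
      obtain ⟨-, _, _, -, -, -, -, h6, -⟩ := ha'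
      rw [h6, h3]
    have e1 : Function.update S.rctr S.ppid ca = S.rctr := by rw [← hr]; simp
    rw [if_pos hr.le, e1]
    have hA : ∀ q k, Announced S q (op q) (st q) k →
        Announced { S with rret := Function.update S.rret S.ppid true } q (op q) (st q) k := by
      rintro q k ⟨h0, a, b, h1, h2, h3, h4, h5, h6, h7⟩
      refine ⟨h0, a, b, h1, h2, h3, h4, h5, fun hr => ⟨(h6 hr).1, fun hr' => ?_⟩, ?_⟩
      · simp only [Function.update_apply] at hr' ⊢
        grind
      · simp only [Function.update_apply]
        grind
    have hI : ∀ ic q k, Informed S ic q k →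
        Informed { S with rret := Function.update S.rret S.ppid true } ic q k := by
      intro ic q k
      simp only [Informed, Function.update_apply]
      grind
    refine ⟨h.even, h.le_pseq, h.pseq_le, ?_, ?_, ?_, ?_⟩
    · intro h3; simp at h3; omega
    · intro _
      by_cases hq : S.ppid = p
      · simp_all [CASLine.posted]
      · simpa [hq] using ⟨l1, l2⟩
    · intro q
      rw [congrFun e q]
      exact h.rctr_eq q
    · rw [e]
      intro q
      by_cases hq : q = p
      · subst hq
        rw [Function.update_self]
        refine ⟨hA _ _ ha, hk, .inr ⟨hk', h1, h4.trans h3.symm, h5, hr.trans h3.symm, by simp⟩, hn⟩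
      · rw [Function.update_of_ne hq]
        refine (h.line q).of_imp rfl rfl (hA _) ?_ ?_ le_rfl id rfl rfl ?_ ?_
        · rintro k pid cp (⟨h1, h2, h3⟩ | h1)
          · exact .inl ⟨h1, hI _ _ _ h2, h3⟩
          · exact .inr h1
        · rintro k pid cp val (⟨h1, h2, h3⟩ | h1)
          · exact .inl ⟨h1, hI _ _ _ h2, h3⟩
          · exact .inr h1
        -- Only decided calls rely on their flag being their result, and the leader is undecided.
        · intro hr
          have : q ≠ S.ppid := by rintro rfl; simp [l2] at hr
          simpa [this] using hr
        · intro val _ h1 h2 h3 _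
          exact ⟨h1, h2, h3, by simp⟩

end Invariant

/-! ### Runs of a sequential object -/

namespace SeqObject

variable (obj : SeqObject)

/-- Applying the operations of a list one after the other leads from `s` to `t` and gives the
return values of the list. -/
def Runs : obj.State → List (obj.Op × obj.Ret) → obj.State → Prop
  | s, [], t => s = t
  | s, (o, v) :: l, t => (obj.T s o).2 = v ∧ Runs (obj.T s o).1 l t

variable {obj}

theorem Runs.cons {s s' t : obj.State} {o : obj.Op} {v : obj.Ret} {l : List (obj.Op × obj.Ret)}
    (hT : obj.T s o = (s', v)) (h : obj.Runs s' l t) : obj.Runs s ((o, v) :: l) t := by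
  simp only [Runs, hT]
  exact ⟨trivial, h⟩

theorem Runs.append {s t u : obj.State} {l l' : List (obj.Op × obj.Ret)} (h : obj.Runs s l t)
    (h' : obj.Runs t l' u) : obj.Runs s (l ++ l') u := by
  induction l generalizing s with
  | nil => cases h; exact h'
  | cons a l ih => exact ⟨h.1, ih h.2⟩

theorem Runs.rets_append {s t : obj.State} {l : List (obj.Op × obj.Ret)} (h : obj.Runs s l t)
    (os : List obj.Op) :
    obj.rets s (l.map Prod.fst ++ os) = l.map Prod.snd ++ obj.rets t os := by
  induction l generalizing s with
  | nil => cases h; rfl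
  | cons a l ih => simp [SeqObject.rets, h.1, ih h.2]

end SeqObject

/-! ### Steps of the algorithm -/

section Steps

variable {n : ℕ} {Val : Type}

theorem CASLine.initCtr_eq_of_posted {l : CASLine n Val} {c : ℕ} (h : l.posted = some c) :
    l.initCtr = c := by
  cases l <;> simp_all [CASLine.posted, CASLine.initCtr]

theorem CASLine.not_isEntry_of_posted {l : CASLine n Val} {c : ℕ} (h : l.posted = some c) :
    ¬ l.IsEntry := by
  cases l <;> simp_all [CASLine.posted, CASLine.IsEntry]

/-- A running call that has not taken effect is a compare-and-swap that expects the current value. -/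
theorem LineInv.of_none {S : Shared n Val} {ic : Fin n → ℕ} {p : Fin n} {op : CASOp Val}
    {l : CASLine n Val} (h : LineInv S ic p op none l) (hl : ¬ l.IsEntry) :
    l.IsLate ∧ ∃ a b, op = .cas a b ∧ a = S.vval := by
  cases l <;> simp_all [LineInv, CASLine.IsEntry, CASLine.IsLate, Pending, Announced] <;> grind

open Classical in
/-- When the sequence number of `V` is raised, all the running calls that have not taken effect do
so. The one in `P` succeeds and the others fail. -/
noncomputable def settle (S : Shared n Val) (cur : Fin n → CASLine n Val)
    (st : Fin n → Option (CASRet Val)) (q : Fin n) : Option (CASRet Val) :=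
  if st q = none ∧ ¬ (cur q).IsEntry then some (.bool (decide (q = S.ppid))) else st q

theorem settle_of_some {S : Shared n Val} {cur : Fin n → CASLine n Val}
    {st : Fin n → Option (CASRet Val)} {q : Fin n} {v : CASRet Val} (h : st q = some v) :
    settle S cur st q = some v := by
  simp [settle, h]

theorem settle_of_none {S : Shared n Val} {cur : Fin n → CASLine n Val}
    {st : Fin n → Option (CASRet Val)} {q : Fin n} (h : st q = none) (h' : ¬ (cur q).IsEntry) :
    settle S cur st q = some (.bool (decide (q = S.ppid))) := by
  simp [settle, h, h']

/-- Process `p` raises the sequence number of `V`. -/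
theorem CASInv.update_step {S : Shared n Val} {cur : Fin n → CASLine n Val} {op : Fin n → CASOp Val}
    {st : Fin n → Option (CASRet Val)} (h : CASInv S cur op st) {p : Fin n} {c : ℕ} {val : Val}
    (hp : cur p = .update c (S.vseq + 2) val) :
    CASInv { S with vseq := S.vseq + 2, vval := val } (Function.update cur p (.retRead c)) op
      (settle S cur st) := by
  have hlp := h.line p
  rw [hp] at hlp
  obtain ⟨ha, hk, hs, hn⟩ := hlp
  obtain ⟨-, hps, ha1, ha2, hr1, hr2⟩ : S.vseq + 2 = S.vseq + 2 ∧ S.pseq = S.vseq + 2 ∧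
      S.actr S.ppid = S.pctr ∧ S.aval S.ppid = val ∧ S.rctr S.ppid = S.pctr ∧
      S.rret S.ppid = true := by
    rcases hs with ⟨hs, -⟩ | hs
    · omega
    · exact hs
  obtain ⟨l1, l2⟩ := h.leader (by omega)
  have hc1 : 1 ≤ S.pctr := ((h.line S.ppid).announced l1).1
  have e := initCtr_update (cur := cur) (p := p) (l := .retRead c) (by simp [hp, CASLine.initCtr])
  have hI : Informed { S with vseq := S.vseq + 2, vval := val } (fun q => (cur q).initCtr)
      S.ppid S.pctr :=
    ⟨hc1, (CASLine.initCtr_eq_of_posted l1).ge, fun _ => ⟨hr1, hr2⟩⟩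
  -- The flags already agree with the outcome: the leader's is true, and a true flag of any other
  -- undecided call would make that call the leader.
  have hA : ∀ q k, ¬ (cur q).IsEntry → Announced S q (op q) (st q) k →
      Announced { S with vseq := S.vseq + 2, vval := val } q (op q) (settle S cur st q) k ∧
        settle S cur st q = some (.bool (S.rret q)) := by
    rintro q k hq ⟨h0, a, b, h1, h2, h3, h4, h5, h6, h7⟩
    have hsome : settle S cur st q = some (.bool (S.rret q)) := by
      cases hst : st q with
      | none =>
        rw [settle_of_none hst hq]
        by_cases hq' : q = S.ppid
        · simp [hq', hr2]
        · have : S.rret q ≠ true := fun hr => hq' ((h6 hst).2 hr).2.1.symm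
          simp_all
      | some v => rw [settle_of_some hst, h7 v hst]
    exact ⟨⟨h0, a, b, h1, h2, h3, h4, h5, by simp [hsome], by simp [hsome]⟩, hsome⟩
  -- A call that is not posted cannot be the leader, so it is decided as a failure, and its `seq` is
  -- now two behind `V.seq`.
  have hP : ∀ q a seq, ¬ (cur q).IsEntry → (cur q).posted = none → Pending S a seq (st q) →
      Pending { S with vseq := S.vseq + 2, vval := val } a seq (settle S cur st q) := by
    rintro q a seq hq hq' ⟨h1, h2, h3⟩
    cases hst : st q with
    | none =>
      have : q ≠ S.ppid := by rintro rfl; simp [l1] at hq'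
      rw [settle_of_none hst hq]
      have := (h2 hst).1
      refine ⟨h1, by simp, ?_⟩
      simp_all
    | some v =>
      rw [settle_of_some hst]
      have := h3 v hst
      refine ⟨h1, by simp, ?_⟩
      simp_all
      omega
  -- A helper that saw the current leader becomes a late one, with its number equal to the new
  -- `V.seq`.
  have hSP : ∀ k pid cp, SawP S (fun q => (cur q).initCtr) k pid cp →
      SawP { S with vseq := S.vseq + 2, vval := val } (fun q => (cur q).initCtr) k pid cp := by
    rintro k pid cp (⟨h1, h2, h3⟩ | ⟨h1, h2, rfl, rfl⟩)
    · exact .inl ⟨by simp; omega, h2, by simp; omega⟩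
    · exact .inl ⟨h1.le, hI, fun _ _ => ha2⟩
  have hSA : ∀ k pid ca v, SawA S (fun q => (cur q).initCtr) k pid ca v →
      SawA { S with vseq := S.vseq + 2, vval := val } (fun q => (cur q).initCtr) k pid ca v := by
    rintro k pid cp v (⟨h1, h2, h3⟩ | ⟨h1, h2, rfl, rfl, h3, rfl⟩)
    · exact .inl ⟨by simp; omega, h2, by simp; omega⟩
    · exact .inl ⟨h1.le, hI, fun _ => ha2⟩
  refine ⟨hk, hps.ge, by simp; omega, ?_, by simp; omega, ?_, ?_⟩
  · rw [e]
    exact fun _ _ => ⟨hI, fun _ => ha2⟩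
  · intro q
    rw [congrFun e q]
    exact h.rctr_eq q
  · rw [e]
    intro q
    by_cases hq : q = p
    · subst hq
      rw [Function.update_self]
      exact (hA q c (by simp [hp, CASLine.IsEntry]) ha).2
    · rw [Function.update_of_ne hq]
      have hA' := hA q
      have hP' := hP q
      have hlq := h.line q
      have hsome : ∀ v, st q = some v → settle S cur st q = some v := fun v hv => settle_of_some hv
      have hent : (cur q).IsEntry → settle S cur st q = st q := by
        intro hc; simp [settle, hc]
      cases hcq : cur q <;> rw [hcq] at hA' hP' hlq hent <;>
        simp only [CASLine.IsEntry, CASLine.posted, not_false_eq_true, forall_const, not_true,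
          false_imp_iff, reduceCtorEq] at hA' hP' hent <;>
        simp only [LineInv] at hlq ⊢
      case readV => rwa [hent]
      case readRet => exact hsome _ hlq
      case rdval => rwa [hent]
      case neq =>
        exact ⟨hlq.1, fun hh => hsome _ (hlq.2.1 hh), fun hh hh' => hsome _ (hlq.2.2.1 hh hh'),
          fun hh hh' => hP' _ _ (hlq.2.2.2 hh hh')⟩
      case neqRet => exact hsome _ hlq
      case eqeq => exact ⟨hlq.1, fun hh => hsome _ (hlq.2.1 hh), fun hh => hP' _ _ (hlq.2.2 hh)⟩
      case eqeqRet => exact hsome _ hlq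
      case count =>
        obtain ⟨a, h1, h2, h3⟩ := hlq
        exact ⟨a, h1, h2, hP' _ _ h3⟩
      case ann =>
        obtain ⟨h0, a, h1, h2, h3⟩ := hlq
        exact ⟨h0, a, h1, h2, hP' _ _ h3⟩
      case init =>
        obtain ⟨h0, a, b, h1, h2, h3, h4⟩ := hlq
        exact ⟨h0, a, b, h1, h2, hP' _ _ h3, h4⟩
      case comp =>
        have := hA' _ hlq.1
        refine ⟨this.1, hlq.2.1, by simp [this.2], fun _ => ?_⟩
        by_cases hst : st q = none
        · exact (congrArg (· + 2) (hlq.2.2.1 hst)).le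
        · exact (hlq.2.2.2 hst).trans (Nat.le_add_right _ _)
      case win =>
        have := hA' _ hlq.1
        refine ⟨this.1, hlq.2.1, by simp [this.2], fun _ => ?_⟩
        by_cases hst : st q = none
        · exact (congrArg (· + 2) (hlq.2.2.1 hst).1).le
        · exact (hlq.2.2.2 hst).trans (Nat.le_add_right _ _)
      case prd =>
        have := hA' _ hlq.1
        exact ⟨this.1, hlq.2.1, by simp [this.2]⟩
      case ard =>
        have := hA' _ hlq.1
        exact ⟨this.1, fun hh => hSP _ _ _ (hlq.2.1 hh), by simp [this.2]⟩
      case chk =>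
        have := hA' _ hlq.1
        exact ⟨this.1, fun hh hh' => hSA _ _ _ _ (hlq.2.1 hh hh'), by simp [this.2]⟩
      case inf =>
        have := hA' _ hlq.1
        exact ⟨this.1, hlq.2.1, hSA _ _ _ _ hlq.2.2.1, by simp [this.2]⟩
      case update =>
        have := hA' _ hlq.1
        refine ⟨this.1, hlq.2.1, .inl ?_, by simp [this.2]⟩
        rcases hlq.2.2.1 with h1 | h1
        · exact ⟨by omega, by omega⟩
        · exact ⟨h1.1.le, fun _ => by rw [← h1.2.2.2.1, ha2]⟩
      case retRead => exact hsome _ hlq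
      case retEnd => exact hsome _ hlq

variable [DecidableEq Val]

/-! ### The calls decided by a single step -/

/-- A step of process `p` makes the calls of the processes in `ls` take effect, in this order and
with these return values, and changes the value of the object from `s` to `s'`. -/
structure TakesEffect (cur : Fin n → CASLine n Val) (op : Fin n → CASOp Val) (p : Fin n)
    (st st' : Fin n → Option (CASRet Val)) (s s' : Val) (ls : List (Fin n × CASRet Val)) : Prop where
  runs : (casObject Val).Runs s (ls.map fun t => (op t.1, t.2)) s'
  nodup : (ls.map Prod.fst).Nodup
  mem : ∀ t ∈ ls, st t.1 = none ∧ st' t.1 = some t.2 ∧ (t.1 = p ∨ (cur t.1).IsLate)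
  keep : ∀ q, (∀ t ∈ ls, t.1 ≠ q) → st' q = st q

theorem TakesEffect.nil (cur : Fin n → CASLine n Val) (op : Fin n → CASOp Val) (p : Fin n)
    (st : Fin n → Option (CASRet Val)) (s : Val) : TakesEffect cur op p st st s s [] :=
  ⟨rfl, List.nodup_nil, by simp, fun _ _ => rfl⟩

theorem TakesEffect.single {cur : Fin n → CASLine n Val} {op : Fin n → CASOp Val} {p : Fin n}
    {st : Fin n → Option (CASRet Val)} {s : Val} {v : CASRet Val} (h : st p = none)
    (hT : (casObject Val).T s (op p) = (s, v)) :
    TakesEffect cur op p st (Function.update st p (some v)) s s [(p, v)] := by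
  refine ⟨.cons hT rfl, by simp, by simp [h], fun q hq => ?_⟩
  have : q ≠ p := by simpa [eq_comm] using hq
  simp [this]

/-- The winner must come first: it finds the old value and installs `val`. All losers expect the old
value, which differs from `val` because the winner has `a ≠ b`; they fail without changing the
state, so their mutual order is irrelevant. -/
theorem TakesEffect.settle {S : Shared n Val} {cur : Fin n → CASLine n Val}
    {op : Fin n → CASOp Val} {st : Fin n → Option (CASRet Val)} (h : CASInv S cur op st) {p : Fin n}
    {c : ℕ} {val : Val} (hp : cur p = .update c (S.vseq + 2) val) :
    ∃ ls, TakesEffect cur op p st (settle S cur st) S.vval val ls := by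
  classical
  have hlp := h.line p
  rw [hp] at hlp
  obtain ⟨-, hk, hs, hn⟩ := hlp
  obtain ⟨hps, ha2⟩ : S.pseq = S.vseq + 2 ∧ S.aval S.ppid = val := by
    rcases hs with ⟨hs, -⟩ | hs
    · omega
    · exact ⟨hs.2.1, hs.2.2.2.1⟩
  obtain ⟨l1, l2⟩ := h.leader (by omega)
  have hent := CASLine.not_isEntry_of_posted l1
  obtain ⟨-, a, b, ho, hab, -, hb, -, hn', -⟩ := (h.line S.ppid).announced l1
  obtain ⟨ha, -⟩ := hn' l2
  have hnone : ∀ q, st q = none → ¬ (cur q).IsEntry →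
      (cur q).IsLate ∧ ∃ a b, op q = .cas a b ∧ a = S.vval := by
    intro q h1 h2
    have := h.line q
    rw [h1] at this
    exact this.of_none h2
  let losers := (List.finRange n).filter fun q => st q = none ∧ ¬ (cur q).IsEntry ∧ q ≠ S.ppid
  have hlos : ∀ q, q ∈ losers ↔ st q = none ∧ ¬ (cur q).IsEntry ∧ q ≠ S.ppid := by
    intro q; simp [losers]
  have hnd : losers.Nodup := (List.nodup_finRange n).filter _
  clear_value losers
  refine ⟨(S.ppid, .bool true) :: losers.map fun q => (q, .bool false), ?_, ?_, ?_, ?_⟩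
  · have hrun : ∀ l : List (Fin n), (∀ q ∈ l, q ∈ losers) →
        (casObject Val).Runs val (l.map fun q => (op q, .bool false)) val := by
      intro l
      induction l with
      | nil => intro _; rfl
      | cons q l ih =>
        intro hl
        obtain ⟨h1, h2, -⟩ := (hlos q).1 (hl q (by simp))
        obtain ⟨-, a', b', ho', ha'⟩ := hnone q h1 h2
        have hne : val ≠ a' := by rw [ha', ← ha, ← ha2, hb]; exact hab.symm
        have hT : (casObject Val).T val (op q) = (val, .bool false) := by simp [ho', hne]
        exact .cons hT (ih fun q hq => hl q (by simp [hq]))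
    have hT : (casObject Val).T S.vval (op S.ppid) = (val, .bool true) := by
      simp [ho, ha, ← ha2, hb]
    simp only [List.map_cons, List.map_map]
    exact .cons hT (hrun losers fun _ h => h)
  · have : (losers.map ((Prod.fst : Fin n × CASRet Val → Fin n) ∘ fun q => (q, .bool false)))
        = losers := by simp [Function.comp_def]
    simp only [List.map_cons, List.map_map, this, List.nodup_cons]
    exact ⟨by simp [hlos], hnd⟩
  · intro t ht
    simp only [List.mem_cons, List.mem_map] at ht
    rcases ht with rfl | ⟨q, hq, rfl⟩
    · exact ⟨l2, by simp [settle_of_none l2 hent], .inr (hnone _ l2 hent).1⟩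
    · obtain ⟨h1, h2, h3⟩ := (hlos q).1 hq
      exact ⟨h1, by simp [settle_of_none h1 h2, h3], .inr (hnone _ h1 h2).1⟩
  · intro q hq
    simp only [List.mem_cons, List.mem_map, forall_eq_or_imp, forall_exists_index, and_imp,
      forall_apply_eq_imp_iff₂] at hq
    have h1 : ¬ (st q = none ∧ ¬ (cur q).IsEntry) := by
      rintro ⟨h1, h2⟩
      exact hq.2 q ((hlos q).2 ⟨h1, h2, fun hh => hq.1 hh.symm⟩) rfl
    simp [_root_.settle, h1]

end Steps

/-! ### From the components of the invariant to instructions on memory -/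

section MemorySteps

variable {n : ℕ} {Val : Type}

theorem Shared.ofMemory_update_V (m : (r : CASReg n) → ℕ × CASReg.Half n Val r) (x : ℕ × Val) :
    ofMemory (Function.update m .V x) = { ofMemory m with vseq := x.1, vval := x.2 } := by
  simp [ofMemory]

theorem Shared.ofMemory_update_P (m : (r : CASReg n) → ℕ × CASReg.Half n Val r)
    (x : ℕ × Fin n × ℕ) :
    ofMemory (Function.update m .P x) =
      { ofMemory m with pseq := x.1, ppid := x.2.1, pctr := x.2.2 } := by
  simp [ofMemory]

theorem Shared.ofMemory_update_A (m : (r : CASReg n) → ℕ × CASReg.Half n Val r) (i : Fin n)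
    (x : ℕ × Val) :
    ofMemory (Function.update m (.A i) x) = { ofMemory m with
      actr := Function.update (ofMemory m).actr i x.1
      aval := Function.update (ofMemory m).aval i x.2 } := by
  have h : ∀ j, Function.update m (.A i) x (.A j) =
      Function.update (fun j => m (.A j)) i x j := by
    intro j
    by_cases hj : j = i
    · subst hj; simp
    · simp [hj]
  simp only [ofMemory, h, ne_eq, reduceCtorEq, not_false_eq_true, Function.update_of_ne]
  congr 1 <;> funext j <;> rcases eq_or_ne j i with rfl | hj
  · simp
  · simp [hj]
  · simp
  · simp [hj]

theorem Shared.ofMemory_update_R (m : (r : CASReg n) → ℕ × CASReg.Half n Val r) (i : Fin n)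
    (x : ℕ × Bool) :
    ofMemory (Function.update m (.R i) x) = { ofMemory m with
      rctr := Function.update (ofMemory m).rctr i x.1
      rret := Function.update (ofMemory m).rret i x.2 } := by
  have h : ∀ j, Function.update m (.R i) x (.R j) =
      Function.update (fun j => m (.R j)) i x j := by
    intro j
    by_cases hj : j = i
    · subst hj; simp
    · simp [hj]
  simp only [ofMemory, h, ne_eq, reduceCtorEq, not_false_eq_true, Function.update_of_ne]
  congr 1 <;> funext j <;> rcases eq_or_ne j i with rfl | hj
  · simp
  · simp [hj]
  · simp
  · simp [hj]

variable [DecidableEq Val] {m : (r : CASReg n) → ℕ × CASReg.Half n Val r}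
  {cur : Fin n → CASLine n Val} {op : Fin n → CASOp Val} {st : Fin n → Option (CASRet Val)}

/-- A register operation of process `p` preserves the invariant. -/
theorem CASInv.regOp_step (h : CASInv (Shared.ofMemory m) cur op st) {p : Fin n} {r : CASReg n}
    {o : RegOp (CASReg.Half n Val r)} {k : o.Ret → CASLine n Val}
    (hi : casInstr n Val p (cur p) = .regOp r o k) :
    ∃ st' ls, CASInv (Shared.ofMemory (Function.update m r (o.apply (m r)).1))
        (Function.update cur p (k (o.apply (m r)).2)) op st' ∧
      TakesEffect cur op p st st' (m .V).2 (Function.update m r (o.apply (m r)).1 .V).2 ls := by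
  have hl := h.line p
  have hpar := h.even
  have hle := h.le_pseq
  have hle' := h.pseq_le
  cases hc : cur p <;> rw [hc] at hi hl <;> cases hi <;>
    simp only [RegOp.apply, Function.update_eq_self]
  case readV c =>
    obtain ⟨h1, h2⟩ := hl
    have := h.local_step p (.readRet c (m .V).2) (some (.val (m .V).2)) (op p)
      (by simp [hc, CASLine.initCtr]) (by simp [hc, CASLine.posted]) rfl
    rw [Function.update_eq_self] at this
    exact ⟨_, _, this, .single h2 (by simp [h1])⟩
  case rdval c a b =>
    obtain ⟨h1, h2⟩ := hl
    have key := fun r => h.local_step p (.neq c a b (m .V).1 (m .V).2) r (op p)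
      (by simp [hc, CASLine.initCtr]) (by simp [hc, CASLine.posted])
    simp only [Function.update_eq_self] at key
    by_cases hab : (m .V).2 = a
    · by_cases hab' : a = b
      · refine ⟨_, _, key (some (.bool true)) ?_, .single h2 (by simp [h1, hab, hab'])⟩
        exact ⟨h1, by simp [hab], by simp, by simp [hab']⟩
      -- The only outcome of reading `V` that leaves a compare-and-swap undecided.
      · refine ⟨_, [], key none ?_, ?_⟩
        · exact ⟨h1, by simp [hab], by simp [hab'],
            fun _ _ => ⟨hpar, fun _ => ⟨rfl, hab.symm⟩, by simp⟩⟩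
        · rw [← h2, Function.update_eq_self]
          exact .nil ..
    · refine ⟨_, _, key (some (.bool false)) ?_, .single h2 (by simp [h1, hab])⟩
      exact ⟨h1, fun _ => rfl, fun hh => absurd hh.symm hab, fun hh => absurd hh.symm hab⟩
  case ann c b seq =>
    refine ⟨st, [], ?_, .nil ..⟩
    rw [Shared.ofMemory_update_A]
    exact h.ann_step hc
  case init c seq =>
    refine ⟨st, [], ?_, .nil ..⟩
    rw [Shared.ofMemory_update_R]
    exact h.init_step hc
  case comp c seq =>
    refine ⟨st, [], ?_, .nil ..⟩
    have := h.comp_step hc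
    rw [Shared.ofMemory_update_P]
    convert this using 1
    by_cases hh : (m .P).1 ≤ seq + 1 <;> simp [Shared.ofMemory, hh]
  case win c seq =>
    refine ⟨st, [], ?_, .nil ..⟩
    have := h.win_step hc
    rw [Shared.ofMemory_update_P]
    exact this
  case prd c =>
    obtain ⟨h1, h2, h3⟩ := hl
    have := h.local_step p (.ard c (m .P).1 (m .P).2.1 (m .P).2.2) (st p) (op p)
      (by simp [hc, CASLine.initCtr]) (by simp [hc, CASLine.posted]) ⟨h1, ?_, h3⟩
    · simp only [Function.update_eq_self] at this
      exact ⟨_, _, this, .nil ..⟩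
    · intro he
      change Even (Shared.ofMemory m).pseq at he
      -- By parity `P.seq` is `V.seq + 2` or `V.seq`. In the second case `2 ≤ P.seq` gives `V.seq ≠
      -- 0`, so what is read is not the arbitrary initial content of `P`.
      rcases Nat.lt_or_ge (Shared.ofMemory m).vseq (Shared.ofMemory m).pseq with hlt | hge
      · exact .inr ⟨by change (Shared.ofMemory m).pseq = _; grind, rfl, rfl, rfl⟩
      · have hs := h.settled (by omega) (by omega)
        exact .inl ⟨hge, hs.1, fun _ => hs.2⟩
  case ard c q pid cp =>
    obtain ⟨h1, h2, h3⟩ := hl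
    have := h.local_step p (.chk c q pid cp (m (.A pid)).1 (m (.A pid)).2) (st p) (op p)
      (by simp [hc, CASLine.initCtr]) (by simp [hc, CASLine.posted]) ⟨h1, ?_, ?_⟩
    · simp only [Function.update_eq_self] at this
      exact ⟨_, _, this, .nil ..⟩
    · rintro he rfl
      rcases h2 he with ⟨h4, h5, h6⟩ | ⟨h4, h5, h6, h7⟩
      · exact .inl ⟨h4, h5, fun hq => h6 hq rfl⟩
      · exact .inr ⟨h4, h5, h6, h7, rfl, rfl⟩
    · intro hr
      refine ⟨h3 hr, ?_⟩
      have hq := h3 hr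
      -- An undecided call has read `q = V.seq + 2`, so the pair it holds is the current leader,
      -- whose announcement still stands in `A`.
      rcases h2 (by grind) with ⟨h4, -⟩ | ⟨h4, h5, rfl, rfl⟩
      · omega
      · obtain ⟨l1, l2⟩ := h.leader (by omega)
        obtain ⟨-, _, _, -, -, h6, -⟩ := (h.line _).announced l1
        exact h6.symm
  case inf c q pid ca val =>
    refine ⟨st, [], ?_, .nil ..⟩
    have := h.inf_step hc
    by_cases hh : (m (.R pid)).1 ≤ ca
    · rw [if_pos (show (Shared.ofMemory m).rctr pid ≤ ca from hh)] at this
      rw [if_pos hh, Shared.ofMemory_update_R]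
      exact this
    · rw [if_neg (show ¬ (Shared.ofMemory m).rctr pid ≤ ca from hh)] at this
      rw [if_neg hh, Function.update_eq_self]
      exact this
  case update c q val =>
    obtain ⟨h1, h2, h3, h4⟩ := hl
    -- If `q = V.seq` the max-write is not refused, but it rewrites the pair already in `V`; hence
    -- `V` changes only when `q = V.seq + 2`.
    by_cases hq : q ≤ (m .V).1
    · have hv : q = (m .V).1 → val = (m .V).2 := by
        rcases h3 with h3 | h3
        · exact h3.2
        · have := h3.1
          simp only [Shared.ofMemory] at this
          omega
      have hsame : (if (m .V).1 ≤ q then (q, val) else m .V) = m .V := by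
        split_ifs with hle
        · have hq' : q = (m .V).1 := by omega
          rw [hv hq', hq']
        · rfl
      have hst : st p ≠ none := by
        intro hst
        have := h4 hst
        simp only [Shared.ofMemory] at this
        omega
      obtain ⟨v, hv'⟩ := Option.ne_none_iff_exists'.1 hst
      rw [hsame, Function.update_eq_self]
      have := h.local_step p (.retRead c) (st p) (op p)
        (by simp [hc, CASLine.initCtr]) (fun _ hh => absurd hh hst) ?_
      · simp only [Function.update_eq_self] at this
        exact ⟨_, _, this, .nil ..⟩
      · obtain ⟨-, _, _, -, -, -, -, -, -, h7⟩ := h1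
        rw [LineInv, hv', h7 v hv']
    · have hq' : q = (Shared.ofMemory m).vseq + 2 := by
        rcases h3 with h3 | h3
        · exact absurd h3.1 hq
        · exact h3.1
      subst hq'
      have hif : (m .V).1 ≤ (Shared.ofMemory m).vseq + 2 := by simp [Shared.ofMemory]
      obtain ⟨ls, hls⟩ := TakesEffect.settle h hc
      rw [if_pos hif]
      refine ⟨settle (Shared.ofMemory m) cur st, ls, ?_, ?_⟩
      · rw [Shared.ofMemory_update_V]
        exact h.update_step hc
      · rw [Function.update_self]
        exact hls
  case retRead c =>
    have := h.local_step p (.retEnd c (m (.R p)).2) (st p) (op p)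
      (by simp [hc, CASLine.initCtr]) (by simp [hc, CASLine.posted]) hl
    simp only [Function.update_eq_self] at this
    exact ⟨_, _, this, .nil ..⟩

/-- A local computation of process `p` preserves the invariant. -/
theorem CASInv.compute_step {S : Shared n Val} (h : CASInv S cur op st) {p : Fin n}
    {k : CASLine n Val} (hi : casInstr n Val p (cur p) = .compute k) :
    CASInv S (Function.update cur p k) op st := by
  have hl := h.line p
  suffices hs : k.initCtr = (cur p).initCtr ∧ ((cur p).posted ≠ none → st p = none →
      k.posted = (cur p).posted ∧ st p = none) ∧
      LineInv S (fun q => (cur q).initCtr) p (op p) (st p) k by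
    have := h.local_step p k (st p) (op p) hs.1 hs.2.1 hs.2.2
    simpa only [Function.update_eq_self] using this
  have hpar := h.even
  cases hc : cur p <;> rw [hc] at hi hl <;> cases hi
  case neq c a b seq val =>
    obtain ⟨h1, h2, h3, h4⟩ := hl
    by_cases hv : a = val
    · rw [if_neg (not_not.2 hv)]
      exact ⟨rfl, by simp [CASLine.posted], h1, h3 hv, h4 hv⟩
    · rw [if_pos hv]
      exact ⟨rfl, by simp [CASLine.posted], h2 hv⟩
  case eqeq c a b seq =>
    obtain ⟨h1, h2, h3⟩ := hl
    by_cases hv : a = b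
    · rw [if_pos hv]
      exact ⟨rfl, by simp [CASLine.posted], h2 hv⟩
    · rw [if_neg hv]
      exact ⟨rfl, by simp [CASLine.posted], a, h1, hv, h3 hv⟩
  case count c b seq =>
    exact ⟨rfl, by simp [CASLine.posted], by omega, hl⟩
  case chk c q pid cp ca val =>
    obtain ⟨h1, h2, h3⟩ := hl
    by_cases hv : Even q ∧ cp = ca
    · rw [if_pos hv]
      exact ⟨rfl, by simp [CASLine.posted], h1, hv.1, h2 hv.1 hv.2, fun hr => (h3 hr).1⟩
    · rw [if_neg hv]
      -- An undecided call always passes the test, so a call that skips the helping lines has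
      -- already been decided.
      have hst : st p ≠ none := by
        intro hst
        obtain ⟨h4, h5⟩ := h3 hst
        exact hv ⟨by grind, h5⟩
      obtain ⟨v, hv'⟩ := Option.ne_none_iff_exists'.1 hst
      refine ⟨rfl, fun _ hh => absurd hh hst, ?_⟩
      obtain ⟨-, _, _, -, -, -, -, -, -, h7⟩ := h1
      rw [LineInv, hv', h7 v hv']

/-- A return of process `p` gives the value with which the call took effect, and preserves the
invariant. -/
theorem CASInv.ret_step {S : Shared n Val} (h : CASInv S cur op st) {p : Fin n} {v : CASRet Val}
    {c : ℕ} (hi : casInstr n Val p (cur p) = .ret v c) :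
    st p = some v ∧ ∀ o, CASInv S (Function.update cur p ((casAlgorithm n Val).entry o c))
      (Function.update op p o) (Function.update st p none) := by
  have hl := h.line p
  suffices hs : st p = some v ∧ c = (cur p).initCtr ∧ (cur p).posted = none by
    refine ⟨hs.1, fun o => ?_⟩
    refine h.local_step p _ none o ?_ (by simp [hs.2.2]) ?_
    · rw [← hs.2.1]
      cases o <;> rfl
    · cases o <;> exact ⟨rfl, rfl⟩
  cases hc : cur p <;> rw [hc] at hi hl <;> cases hi <;> exact ⟨hl, rfl, rfl⟩

/-- A late call at `neq` or `eqeq` has `a = val` or `a ≠ b`, as needed, and so does not branch to an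
early return. Since no late line is a return (`CASLine.not_isLate_of_ret`), a late call leaves the
late lines only through a register operation. -/
theorem CASLine.IsLate.compute {l k : CASLine n Val} {p : Fin n} (h : l.IsLate)
    (hi : casInstr n Val p l = .compute k) : k.IsLate := by
  cases l <;> cases hi <;> simp only [CASLine.IsLate] at h
  case neq => simpa [h.1, CASLine.IsLate] using h.1 ▸ h.2
  case eqeq => simp [h, CASLine.IsLate]
  case count => trivial
  case chk => split_ifs <;> trivial

theorem CASLine.not_isLate_of_ret {l : CASLine n Val} {p : Fin n} {v : CASRet Val} {c : ℕ}
    (hi : casInstr n Val p l = .ret v c) : ¬ l.IsLate := by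
  cases l <;> cases hi <;> simp [CASLine.IsLate]

end MemorySteps

/-! ### Executions -/

namespace Implementation

variable {n : ℕ} {State Op Ret : Type} (I : Implementation n State Op Ret)

/-- The configuration that is reached from `C` under a schedule. -/
def run (w : Fin n → ℕ → Op) (C : I.Config) (σ : List (Fin n)) : I.Config :=
  σ.foldl (fun C p => (I.step w C p).1) C

theorem exec_append (w : Fin n → ℕ → Op) (C : I.Config) (σ τ : List (Fin n)) :
    I.exec w C (σ ++ τ) = I.exec w C σ ++ I.exec w (I.run w C σ) τ := by
  induction σ generalizing C with
  | nil => rfl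
  | cons p σ ih => simp [exec, run, ih]

theorem run_concat (w : Fin n → ℕ → Op) (C : I.Config) (σ : List (Fin n)) (p : Fin n) :
    I.run w C (σ ++ [p]) = (I.step w (I.run w C σ) p).1 := by
  simp [run]

theorem exec_concat (w : Fin n → ℕ → Op) (C : I.Config) (σ : List (Fin n)) (p : Fin n) :
    I.exec w C (σ ++ [p]) = I.exec w C σ ++ [(I.step w (I.run w C σ) p).2] := by
  simp [exec_append, exec]

/-- The control point of the next instruction of process `p`. -/
def cur (w : Fin n → ℕ → Op) (C : I.Config) (p : Fin n) : I.Ctl :=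
  (C.ctl p).getD (I.entry (w p (C.done p)) (C.vars p))

variable {I} {w : Fin n → ℕ → Op} {C : I.Config} {p : Fin n}

theorem step_regOp {r : I.Reg} {o : RegOp (I.Half r)} {k : o.Ret → I.Ctl}
    (h : I.instr p (I.cur w C p) = .regOp r o k) :
    I.step w C p = ({ C with
      mem := Function.update C.mem r (o.apply (C.mem r)).1
      ctl := Function.update C.ctl p (some (k (o.apply (C.mem r)).2)) },
      ⟨(p, C.done p), .regOp⟩) := by
  unfold step
  unfold cur at h
  rw [h]

theorem step_compute {k : I.Ctl} (h : I.instr p (I.cur w C p) = .compute k) :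
    I.step w C p = ({ C with ctl := Function.update C.ctl p (some k) },
      ⟨(p, C.done p), .compute⟩) := by
  unfold step
  unfold cur at h
  rw [h]

theorem step_ret {v : Ret} {vars : I.Vars} (h : I.instr p (I.cur w C p) = .ret v vars) :
    I.step w C p = ({ C with
      vars := Function.update C.vars p vars
      ctl := Function.update C.ctl p none
      done := Function.update C.done p (C.done p + 1) }, ⟨(p, C.done p), .ret v⟩) := by
  unfold step
  unfold cur at h
  rw [h]

theorem cur_ctl (m : I.Memory) (l : I.Ctl) :
    I.cur w { C with mem := m, ctl := Function.update C.ctl p (some l) } =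
      Function.update (I.cur w C) p l := by
  funext q
  by_cases hq : q = p
  · subst hq; simp [cur]
  · simp [cur, hq]

theorem cur_ret (vars : I.Vars) :
    I.cur w { C with
      vars := Function.update C.vars p vars
      ctl := Function.update C.ctl p none
      done := Function.update C.done p (C.done p + 1) } =
      Function.update (I.cur w C) p (I.entry (w p (C.done p + 1)) vars) := by
  funext q
  by_cases hq : q = p
  · subst hq; simp [cur]
  · simp [cur, hq]

theorem cur_step_of_ne {q : Fin n} (hq : q ≠ p) :
    I.cur w (I.step w C p).1 q = I.cur w C q ∧ (I.step w C p).1.done q = C.done q := by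
  cases h : I.instr p (I.cur w C p) with
  | regOp r o k =>
    rw [step_regOp h, cur_ctl]
    simp [hq]
  | compute k =>
    rw [step_compute h]
    have := cur_ctl (w := w) (C := C) (p := p) C.mem k
    simp only at this ⊢
    rw [this]
    simp [hq]
  | ret v c =>
    rw [step_ret h, cur_ret]
    simp [hq]

end Implementation

/-! ### Bounds on the number of steps -/

section Steps

variable {n : ℕ} {State Op Ret : Type} {I : Implementation n State Op Ret}

/-- A rank on the control points that is smaller than `K`, starts at `0` and increases with every
instruction that is not a return. -/
structure IsRank (I : Implementation n State Op Ret) (K : ℕ) (rank : I.Ctl → ℕ) : Prop where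
  lt : ∀ l, rank l < K
  entry : ∀ o c, rank (I.entry o c) = 0
  regOp : ∀ p l r o k, I.instr p l = .regOp r o k → ∀ v, rank l < rank (k v)
  compute : ∀ p l k, I.instr p l = .compute k → rank l < rank k

/-- Counting the steps of the calls: at most the rank for the current call. -/
theorem IsRank.stepsOf_le {K : ℕ} {rank : I.Ctl → ℕ} (hr : IsRank I K rank)
    (w : Fin n → ℕ → Op) (m : I.Memory) (σ : List (Fin n)) (p : Fin n) :
    (∀ k, k < (I.run w (I.initial m) σ).done p → stepsOf (I.exec w (I.initial m) σ) (p, k) ≤ K ∧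
      ∃ v, Returns (I.exec w (I.initial m) σ) (p, k) v) ∧
    stepsOf (I.exec w (I.initial m) σ) (p, (I.run w (I.initial m) σ).done p) ≤
      rank (I.cur w (I.run w (I.initial m) σ) p) ∧
    ∀ k, (I.run w (I.initial m) σ).done p < k → stepsOf (I.exec w (I.initial m) σ) (p, k) = 0 := by
  induction σ using List.reverseRecOn with
  | nil => simp [Implementation.exec, Implementation.run, Implementation.initial, stepsOf]
  | append_singleton σ q ih =>
    rw [I.exec_concat, I.run_concat]
    generalize I.run w (I.initial m) σ = C at *
    generalize I.exec w (I.initial m) σ = E at *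
    obtain ⟨ih1, ih2, ih3⟩ := ih
    have hmono : ∀ e c, (∃ v, Returns E c v) → ∃ v, Returns (E ++ [e]) c v := by
      rintro e c ⟨v, hv⟩
      exact ⟨v, List.mem_append_left _ hv⟩
    have hne : ∀ e : Event n Ret, ∀ c, e.call ≠ c → stepsOf (E ++ [e]) c = stepsOf E c := by
      intro e c hec
      simp [stepsOf, hec]
    have heq : ∀ e : Event n Ret, stepsOf (E ++ [e]) e.call = stepsOf E e.call + 1 := by
      intro e
      simp [stepsOf]
    by_cases hq : p = q
    · subst hq
      cases h : I.instr p (I.cur w C p) with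
      | regOp r o k =>
        rw [Implementation.step_regOp h, Implementation.cur_ctl]
        refine ⟨fun j hj => ?_, ?_, fun j hj => ?_⟩
        · rw [hne _ _ (by simpa using (show j < C.done p from hj).ne')]
          exact ⟨(ih1 j hj).1, hmono _ _ (ih1 j hj).2⟩
        · rw [Function.update_self]
          refine (heq ⟨(p, C.done p), .regOp⟩).trans_le ?_
          exact Nat.succ_le_of_lt (ih2.trans_lt (hr.regOp _ _ _ _ _ h _))
        · rw [hne _ _ (by simpa using (show C.done p < j from hj).ne)]
          exact ih3 j hj
      | compute k =>
        rw [Implementation.step_compute h]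
        have e := Implementation.cur_ctl (w := w) (C := C) (p := p) C.mem k
        simp only at e ⊢
        rw [e]
        refine ⟨fun j hj => ?_, ?_, fun j hj => ?_⟩
        · rw [hne _ _ (by simpa using (show j < C.done p from hj).ne')]
          exact ⟨(ih1 j hj).1, hmono _ _ (ih1 j hj).2⟩
        · rw [Function.update_self]
          refine (heq ⟨(p, C.done p), .compute⟩).trans_le ?_
          exact Nat.succ_le_of_lt (ih2.trans_lt (hr.compute _ _ _ h))
        · rw [hne _ _ (by simpa using (show C.done p < j from hj).ne)]
          exact ih3 j hj
      | ret v c =>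
        rw [Implementation.step_ret h, Implementation.cur_ret]
        simp only [Function.update_self, hr.entry, Nat.le_zero]
        refine ⟨fun j hj => ?_, ?_, fun j hj => ?_⟩
        · rcases Nat.lt_succ_iff_lt_or_eq.1 hj with hj | rfl
          · rw [hne _ _ (by simpa using hj.ne')]
            exact ⟨(ih1 j hj).1, hmono _ _ (ih1 j hj).2⟩
          · refine ⟨(heq ⟨(p, C.done p), .ret v⟩).trans_le ?_, v, by simp [Returns]⟩
            exact Nat.succ_le_of_lt (ih2.trans_lt (hr.lt _))
        · rw [hne _ _ (by simp)]
          exact ih3 _ (Nat.lt_succ_self _)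
        · rw [hne _ _ (by simp; omega)]
          exact ih3 j (by omega)
    · obtain ⟨e1, e2⟩ := Implementation.cur_step_of_ne (w := w) (C := C) hq
      have e3 : (I.step w C q).2.call.1 = q := by
        cases h : I.instr q (I.cur w C q) with
        | regOp r o k => rw [Implementation.step_regOp h]
        | compute k => rw [Implementation.step_compute h]
        | ret v c => rw [Implementation.step_ret h]
      have e4 : ∀ k, stepsOf (E ++ [(I.step w C q).2]) (p, k) = stepsOf E (p, k) := by
        intro k
        refine hne _ _ fun hh => hq ?_
        rw [← e3, hh]
      rw [e1, e2]
      simp only [e4]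
      exact ⟨fun k hk => ⟨(ih1 k hk).1, hmono _ _ (ih1 k hk).2⟩, ih2, ih3⟩

theorem IsRank.stepBound {K : ℕ} {rank : I.Ctl → ℕ} (hr : IsRank I K rank) : I.StepBound K := by
  rintro x m - w σ ⟨p, k⟩
  obtain ⟨h1, h2, h3⟩ := hr.stepsOf_le w m σ p
  rcases lt_trichotomy k ((I.run w (I.initial m) σ).done p) with h | rfl | h
  · exact (h1 k h).1
  · exact h2.trans (hr.lt _).le
  · rw [h3 k h]
    exact Nat.zero_le K

/-- Each step of `p` before the return raises the rank by at least one and steps of other processes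
leave it alone, so the sum of remaining steps and rank does not drop below `K`. As ranks stay below
`K`, the steps cannot run out first. -/
theorem IsRank.returns {K : ℕ} {rank : I.Ctl → ℕ} (hr : IsRank I K rank) (w : Fin n → ℕ → Op)
    (C : I.Config) (p : Fin n) (τ : List (Fin n)) (h : K ≤ τ.count p + rank (I.cur w C p)) :
    ∃ v, Returns (I.exec w C τ) (p, C.done p) v := by
  induction τ generalizing C with
  | nil =>
    have := hr.lt (I.cur w C p)
    simp at h
    omega
  | cons q τ ih =>
    by_cases hq : p = q
    · subst hq
      rw [List.count_cons_self] at h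
      cases hi : I.instr p (I.cur w C p) with
      | regOp r o k =>
        have hlt := hr.regOp _ _ _ _ _ hi (o.apply (C.mem r)).2
        obtain ⟨v, hv⟩ := ih (I.step w C p).1 (by
          rw [Implementation.step_regOp hi, Implementation.cur_ctl, Function.update_self]
          omega)
        refine ⟨v, List.mem_cons_of_mem _ ?_⟩
        rwa [Returns, show (I.step w C p).1.done p = C.done p by
          rw [Implementation.step_regOp hi]] at hv
      | compute k =>
        have hlt := hr.compute _ _ _ hi
        obtain ⟨v, hv⟩ := ih (I.step w C p).1 (by
          have e := Implementation.cur_ctl (w := w) (C := C) (p := p) C.mem k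
          rw [Implementation.step_compute hi]
          simp only at e ⊢
          rw [e, Function.update_self]
          omega)
        refine ⟨v, List.mem_cons_of_mem _ ?_⟩
        rwa [Returns, show (I.step w C p).1.done p = C.done p by
          rw [Implementation.step_compute hi]] at hv
      | ret v c =>
        refine ⟨v, List.mem_cons.2 (.inl ?_)⟩
        rw [Implementation.step_ret hi]
    · obtain ⟨e1, e2⟩ := Implementation.cur_step_of_ne (w := w) (C := C) hq
      rw [List.count_cons_of_ne (Ne.symm hq)] at h
      obtain ⟨v, hv⟩ := ih (I.step w C q).1 (by rwa [e1])
      rw [e2] at hv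
      exact ⟨v, List.mem_cons_of_mem _ hv⟩

theorem IsRank.waitFree {K : ℕ} {rank : I.Ctl → ℕ} (hr : IsRank I K rank) : I.WaitFree := by
  rintro x m - w σ ⟨p, k⟩ hc
  refine ⟨K, fun τ hτ => ?_⟩
  rw [I.exec_append]
  obtain ⟨h1, h2, h3⟩ := hr.stepsOf_le w m σ p
  rcases lt_trichotomy k ((I.run w (I.initial m) σ).done p) with h | rfl | h
  · obtain ⟨v, hv⟩ := (h1 k h).2
    exact ⟨v, List.mem_append_left _ hv⟩
  · obtain ⟨v, hv⟩ := hr.returns w (I.run w (I.initial m) σ) p τ (hτ.trans (Nat.le_add_right _ _))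
    exact ⟨v, List.mem_append_right _ hv⟩
  · obtain ⟨e, he, hec⟩ := hc
    have := List.countP_eq_zero.1 (h3 k h) e he
    simp [hec] at this

/-- The number of instructions that come before a line in its function, at most. -/
def CASLine.rank {Val : Type} : CASLine n Val → ℕ
  | readV _ => 0
  | readRet _ _ => 1
  | rdval _ _ _ => 0
  | neq _ _ _ _ _ => 1
  | neqRet _ => 2
  | eqeq _ _ _ _ => 2
  | eqeqRet _ => 3
  | count _ _ _ => 3
  | ann _ _ _ => 4
  | init _ _ => 5
  | comp _ _ => 6
  | win _ _ => 7
  | prd _ => 8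
  | ard _ _ _ _ => 9
  | chk _ _ _ _ _ _ => 10
  | inf _ _ _ _ _ => 11
  | update _ _ _ => 12
  | retRead _ => 13
  | retEnd _ _ => 14

/-- Control only moves forward. The longest path, from `rdval` through the helping lines to
`retEnd`, has 15 instructions. -/
theorem CASLine.isRank (n : ℕ) (Val : Type) [DecidableEq Val] :
    IsRank (casAlgorithm n Val) 15 CASLine.rank where
  lt l := by cases l <;> simp [CASLine.rank]
  entry o c := by cases o <;> rfl
  regOp p l r o k h v := by
    change casInstr n Val p l = _ at h
    cases l <;> cases h <;> simp [CASLine.rank]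
  compute p l k h := by
    change casInstr n Val p l = _ at h
    cases l <;> cases h <;> (try split_ifs) <;> simp [CASLine.rank]

end Steps

/-! ### Linearizability -/

section Linearization

/-- The call `call` takes effect with the `time`-th instruction and the return value `ret`. -/
structure Effect (n : ℕ) (Ret : Type) where
  call : CallId n
  ret : Ret
  time : ℕ

theorem RegOpAt.append {n : ℕ} {Ret : Type} {E : List (Event n Ret)} {c : CallId n} {i : ℕ}
    (h : RegOpAt E c i) (e : Event n Ret) : RegOpAt (E ++ [e]) c i := by
  have hi : i < E.length := (List.getElem?_eq_some_iff.1 h).1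
  rw [RegOpAt, List.getElem?_append_left hi]
  exact h

theorem regOpAt_concat {n : ℕ} {Ret : Type} (E : List (Event n Ret)) (c : CallId n) :
    RegOpAt (E ++ [⟨c, .regOp⟩]) c E.length := by
  simp [RegOpAt]

/-- The calls that have taken effect, in the order in which they did so, followed by the others,
are a linearization. -/
theorem isLinearization_of_effects {n : ℕ} {obj : SeqObject} {x s : obj.State}
    {w : Fin n → ℕ → obj.Op} {E : List (Event n obj.Ret)} {H : List (Effect n obj.Ret)}
    (runs : obj.Runs x (H.map fun t => (w t.call.1 t.call.2, t.ret)) s)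
    (nodup : (H.map Effect.call).Nodup)
    (sorted : H.Pairwise fun t t' => t.time ≤ t'.time)
    (started : ∀ t ∈ H, ∃ j ≤ t.time, RegOpAt E t.call j)
    (ended : ∀ t ∈ H, (∃ v, Returns E t.call v) → ∃ j ≥ t.time, RegOpAt E t.call j)
    (returned : ∀ c v, Returns E c v → ∃ i, ⟨c, v, i⟩ ∈ H) :
    ∃ L, IsLinearization obj x w E L := by
  classical
  let rest := (E.map Event.call).dedup.filter fun c => c ∉ H.map Effect.call
  have hrest : ∀ c, c ∈ rest ↔ Appears E c ∧ c ∉ H.map Effect.call := by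
    intro c
    simp only [rest, List.mem_filter, List.mem_dedup, List.mem_map, Appears, decide_eq_true_eq]
  have hrest' : rest.Nodup := (List.nodup_dedup _).filter _
  clear_value rest
  -- Calls without an effect are unfinished. They are `Before` nothing and no return value is
  -- required of them, so they may all stand at the end.
  have hunret : ∀ c ∈ rest, ∀ v, ¬ Returns E c v := by
    intro c hc v hv
    obtain ⟨i, hi⟩ := returned c v hv
    exact ((hrest c).1 hc).2 (List.mem_map.2 ⟨_, hi, rfl⟩)
  refine ⟨H.map Effect.call ++ rest, ?_, ?_, ?_, ?_⟩
  · rw [List.nodup_append']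
    exact ⟨nodup, hrest', fun c h1 h2 => ((hrest c).1 h2).2 h1⟩
  · intro c
    rw [List.mem_append, hrest]
    refine ⟨?_, fun h => ?_⟩
    · rintro (h | h)
      · obtain ⟨t, ht, rfl⟩ := List.mem_map.1 h
        obtain ⟨j, -, hj⟩ := started t ht
        exact ⟨_, List.mem_of_getElem? hj, rfl⟩
      · exact h.1
    · by_cases hc : c ∈ H.map Effect.call
      · exact .inl hc
      · exact .inr ⟨h, hc⟩
  · rw [List.pairwise_append]
    have hno : ∀ A, ∀ B ∈ rest, ¬ Before E B A := by
      rintro A B hB ⟨i, j, ⟨⟨v, hv⟩, -⟩, -⟩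
      exact hunret B hB v hv
    refine ⟨?_, List.Pairwise.imp_of_mem (fun _ hB _ => hno _ _ hB)
      (List.pairwise_of_forall (R := fun _ _ => True) fun _ _ => trivial),
      fun A _ B hB => hno A B hB⟩
    rw [List.pairwise_map]
    refine sorted.imp_of_mem ?_
    -- The start of `t` is at most `t.time ≤ t'.time`, which is at most the end of `t'`. Equal times
    -- do no harm, because `Before` is strict.
    rintro t t' ht ht' hle ⟨i, j, ⟨hv, -, hi⟩, ⟨-, hj⟩, hij⟩
    obtain ⟨a, ha, ha'⟩ := started t ht
    obtain ⟨b, hb, hb'⟩ := ended t' ht' hv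
    have := hi b hb'
    have := hj a ha'
    omega
  · intro i c v hi hv
    obtain ⟨k, hk⟩ := returned c v hv
    have hlt : i < H.length := by
      by_contra hge
      rw [List.getElem?_append_right (by simpa using hge)] at hi
      exact hunret c (List.mem_of_getElem? hi) v hv
    rw [List.getElem?_append_left (by simpa using hlt)] at hi
    rw [List.map_append]
    have hmap : (H.map Effect.call).map (fun c => w c.1 c.2) =
        (H.map fun t => (w t.call.1 t.call.2, t.ret)).map Prod.fst := by
      simp [List.map_map, Function.comp_def]
    rw [hmap, runs.rets_append, List.getElem?_append_left (by simpa using hlt)]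
    rw [List.getElem?_map, List.getElem?_eq_getElem hlt, Option.map_some, Option.some_inj] at hi
    have : H[i] = ⟨c, v, k⟩ := List.inj_on_of_nodup_map nodup (List.getElem_mem hlt) hk hi
    simp [hlt, this]

/-! ### The history of effects along an execution -/

variable {n : ℕ} {Val : Type} [DecidableEq Val]

/-- The invariant of an execution `E` that has led to `C`: besides the invariant of the algorithm,
`H` lists the calls that have taken effect. -/
structure HistoryInv (x : Val) (w : Fin n → ℕ → CASOp Val) (C : (casAlgorithm n Val).Config)
    (E : List (Event n (CASRet Val))) (st : Fin n → Option (CASRet Val))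
    (H : List (Effect n (CASRet Val))) : Prop where
  inv : CASInv (Shared.ofMemory C.mem) ((casAlgorithm n Val).cur w C) (fun q => w q (C.done q)) st
  runs : (casObject Val).Runs x (H.map fun t => (w t.call.1 t.call.2, t.ret)) (C.mem .V).2
  nodup : (H.map Effect.call).Nodup
  sorted : H.Pairwise fun t t' => t.time ≤ t'.time
  started : ∀ t ∈ H, ∃ j ≤ t.time, RegOpAt E t.call j
  time_lt : ∀ t ∈ H, t.time < E.length
  ended : ∀ t ∈ H, (∃ j ≥ t.time, RegOpAt E t.call j) ∨
    (t.call.2 = C.done t.call.1 ∧ ((casAlgorithm n Val).cur w C t.call.1).IsLate)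
  effective : ∀ t ∈ H, t.call.2 < C.done t.call.1 ∨
    (t.call.2 = C.done t.call.1 ∧ st t.call.1 = some t.ret)
  current : ∀ p v, st p = some v → ∃ i, ⟨(p, C.done p), v, i⟩ ∈ H
  returned : ∀ c v, Returns E c v → (∃ i, ⟨c, v, i⟩ ∈ H) ∧ c.2 < C.done c.1
  running : ∀ p, C.ctl p ≠ none → ∃ j, RegOpAt E (p, C.done p) j

theorem HistoryInv.initial {x : Val} {m : (casAlgorithm n Val).Memory}
    (hm : (casAlgorithm n Val).IsInit x m) (w : Fin n → ℕ → CASOp Val) :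
    HistoryInv x w ((casAlgorithm n Val).initial m) [] (fun _ => none) [] := by
  obtain ⟨h1, h2⟩ := hm
  constructor <;> try simp [Returns, Implementation.initial]
  · have e1 : (Shared.ofMemory m).vseq = 0 := by simp [Shared.ofMemory, h1]
    have e2 : (Shared.ofMemory m).pseq = 0 := h2
    refine ⟨?_, ?_, ?_, ?_, ?_, ?_, ?_⟩
    · simp [e1]
    · omega
    · omega
    -- The invariant asserts nothing about the contents of `P` while `V.seq = 0`, since they are
    -- arbitrary apart from `P.seq = 0`.
    · intro _ hh; exact absurd e1 hh
    · intro hh; omega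
    · intro q hq
      change 1 ≤ ((casAlgorithm n Val).entry (w q 0) 0).initCtr at hq
      cases hw : w q 0 <;> simp [hw, CASLine.initCtr] at hq
    · intro q
      change LineInv _ _ _ _ _ ((casAlgorithm n Val).entry (w q 0) 0)
      cases hw : w q 0 <;> exact ⟨by simp, rfl⟩
  · simp [SeqObject.Runs, h1]

/-- Only register operations decide calls. All calls decided by this one are appended with the same
time, the index `E.length` of the new instruction. -/
theorem HistoryInv.step_regOp {x : Val} {w : Fin n → ℕ → CASOp Val}
    {C : (casAlgorithm n Val).Config} {E : List (Event n (CASRet Val))}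
    {st : Fin n → Option (CASRet Val)} {H : List (Effect n (CASRet Val))}
    (h : HistoryInv x w C E st H) {p : Fin n} {r : CASReg n} {o : RegOp (CASReg.Half n Val r)}
    {k : o.Ret → CASLine n Val}
    (hi : casInstr n Val p ((casAlgorithm n Val).cur w C p) = .regOp r o k) :
    ∃ st' H', HistoryInv x w ((casAlgorithm n Val).step w C p).1
      (E ++ [((casAlgorithm n Val).step w C p).2]) st' H' := by
  obtain ⟨st', ls, hinv, heff⟩ := h.inv.regOp_step hi
  have hst := Implementation.step_regOp (I := casAlgorithm n Val) hi
  rw [hst]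
  have hcur := Implementation.cur_ctl (I := casAlgorithm n Val) (w := w) (C := C) (p := p)
    (Function.update C.mem r (o.apply (C.mem r)).1) (k (o.apply (C.mem r)).2)
  -- A call decided by another process is at a late line, hence not at the first line of a function.
  -- So it is running and has already executed a register operation.
  have hrun : ∀ t ∈ ls, ∃ j ≤ E.length,
      RegOpAt (E ++ [⟨(p, C.done p), .regOp⟩]) (t.1, C.done t.1) j := by
    intro t ht
    by_cases htp : t.1 = p
    · exact ⟨E.length, le_rfl, htp ▸ regOpAt_concat E (p, C.done p)⟩
    · have hlate := ((heff.mem t ht).2.2).resolve_left htp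
      have hctl : C.ctl t.1 ≠ none := by
        intro hnone
        rw [Implementation.cur, hnone] at hlate
        cases hw : w t.1 (C.done t.1) <;> simp [hw, CASLine.IsLate] at hlate
      obtain ⟨j, hj⟩ := h.running t.1 hctl
      exact ⟨j, (List.getElem?_eq_some_iff.1 hj).1.le, hj.append _⟩
  -- A call in `H` is either finished or recorded as decided in `st`, so it is not decided a second
  -- time.
  have hnew : ∀ t ∈ ls, (t.1, C.done t.1) ∉ H.map Effect.call := by
    intro t ht hmem
    obtain ⟨u, hu, hc⟩ := List.mem_map.1 hmem
    have h1 := (heff.mem t ht).1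
    rcases h.effective u hu with h2 | ⟨-, h2⟩
    · rw [hc] at h2
      exact lt_irrefl _ h2
    · rw [hc, h1] at h2
      cases h2
  refine ⟨st', H ++ ls.map fun t => ⟨(t.1, C.done t.1), t.2, E.length⟩, ?_⟩
  constructor
  · rw [hcur]
    exact hinv
  · rw [List.map_append, List.map_map]
    exact h.runs.append heff.runs
  · rw [List.map_append, List.map_map, List.nodup_append']
    refine ⟨h.nodup, ?_, ?_⟩
    · refine List.Nodup.of_map Prod.fst ?_
      rw [List.map_map]
      exact heff.nodup
    · intro c h1 h2
      obtain ⟨t, ht, rfl⟩ := List.mem_map.1 h2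
      exact hnew t ht h1
  · rw [List.pairwise_append, List.pairwise_map]
    refine ⟨h.sorted, List.pairwise_of_forall fun _ _ => le_rfl, ?_⟩
    intro t ht t' ht'
    obtain ⟨u, hu, rfl⟩ := List.mem_map.1 ht'
    exact (h.time_lt t ht).le
  · intro t ht
    rcases List.mem_append.1 ht with ht | ht
    · obtain ⟨j, hj, hj'⟩ := h.started t ht
      exact ⟨j, hj, hj'.append _⟩
    · obtain ⟨u, hu, rfl⟩ := List.mem_map.1 ht
      exact hrun u hu
  · intro t ht
    rw [List.length_append, List.length_singleton]
    rcases List.mem_append.1 ht with ht | ht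
    · exact Nat.lt_succ_of_lt (h.time_lt t ht)
    · obtain ⟨u, hu, rfl⟩ := List.mem_map.1 ht
      exact Nat.lt_succ_self _
  · intro t ht
    rw [hcur]
    rcases List.mem_append.1 ht with ht | ht
    · rcases h.ended t ht with ⟨j, hj, hj'⟩ | ⟨h1, h2⟩
      · exact .inl ⟨j, hj, hj'.append _⟩
      -- If the late call is the one taking this step, the step itself is the register operation
      -- after its effect.
      · by_cases hp : t.call.1 = p
        · refine .inl ⟨E.length, (h.time_lt t ht).le, ?_⟩
          have : t.call = (p, C.done p) := Prod.ext hp (by rw [h1, hp])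
          rw [this]
          exact regOpAt_concat E _
        · exact .inr ⟨h1, by rwa [Function.update_of_ne hp]⟩
    · obtain ⟨u, hu, rfl⟩ := List.mem_map.1 ht
      rcases eq_or_ne u.1 p with hp | hp
      · exact .inl ⟨E.length, le_rfl, by simpa only [hp] using regOpAt_concat E (p, C.done p)⟩
      · refine .inr ⟨rfl, ?_⟩
        simp only [Function.update_of_ne hp]
        exact ((heff.mem u hu).2.2).resolve_left hp
  · intro t ht
    rcases List.mem_append.1 ht with ht | ht
    · rcases h.effective t ht with h1 | ⟨h1, h2⟩
      · exact .inl h1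
      · refine .inr ⟨h1, ?_⟩
        rw [heff.keep, h2]
        intro u hu huc
        rw [← huc, (heff.mem u hu).1] at h2
        cases h2
    · obtain ⟨u, hu, rfl⟩ := List.mem_map.1 ht
      exact .inr ⟨rfl, (heff.mem u hu).2.1⟩
  · intro q v hv
    by_cases hq : ∃ t ∈ ls, t.1 = q
    · obtain ⟨t, ht, rfl⟩ := hq
      have : v = t.2 := by simpa [(heff.mem t ht).2.1, eq_comm] using hv
      exact ⟨E.length, List.mem_append_right _ (List.mem_map.2 ⟨t, ht, by rw [this]⟩)⟩
    · push Not at hq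
      rw [heff.keep q hq] at hv
      obtain ⟨i, hi⟩ := h.current q v hv
      exact ⟨i, List.mem_append_left _ hi⟩
  · intro c v hv
    rcases List.mem_append.1 hv with hv | hv
    · obtain ⟨⟨i, hi⟩, hd⟩ := h.returned c v hv
      exact ⟨⟨i, List.mem_append_left _ hi⟩, hd⟩
    · simp at hv
  · intro q hq
    by_cases hqp : q = p
    · subst hqp
      exact ⟨E.length, regOpAt_concat E _⟩
    · simp only [Function.update_of_ne hqp] at hq
      obtain ⟨j, hj⟩ := h.running q hq
      exact ⟨j, hj.append _⟩

theorem HistoryInv.step_compute {x : Val} {w : Fin n → ℕ → CASOp Val}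
    {C : (casAlgorithm n Val).Config} {E : List (Event n (CASRet Val))}
    {st : Fin n → Option (CASRet Val)} {H : List (Effect n (CASRet Val))}
    (h : HistoryInv x w C E st H) {p : Fin n} {k : CASLine n Val}
    (hi : casInstr n Val p ((casAlgorithm n Val).cur w C p) = .compute k) :
    HistoryInv x w ((casAlgorithm n Val).step w C p).1
      (E ++ [((casAlgorithm n Val).step w C p).2]) st H := by
  have hst := Implementation.step_compute (I := casAlgorithm n Val) hi
  rw [hst]
  have hcur := Implementation.cur_ctl (I := casAlgorithm n Val) (w := w) (C := C) (p := p) C.mem k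
  constructor
  · exact hcur ▸ h.inv.compute_step hi
  · exact h.runs
  · exact h.nodup
  · exact h.sorted
  · intro t ht
    obtain ⟨j, hj, hj'⟩ := h.started t ht
    exact ⟨j, hj, hj'.append _⟩
  · intro t ht
    rw [List.length_append]
    exact Nat.lt_add_right _ (h.time_lt t ht)
  · intro t ht
    rcases h.ended t ht with ⟨j, hj, hj'⟩ | ⟨h1, h2⟩
    · exact .inl ⟨j, hj, hj'.append _⟩
    · refine .inr ⟨h1, ?_⟩
      refine (congrFun hcur t.call.1).symm ▸ ?_
      by_cases hp : t.call.1 = p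
      · rw [hp] at h2 ⊢
        rw [Function.update_self]
        exact h2.compute hi
      · rwa [Function.update_of_ne hp]
  · exact h.effective
  · exact h.current
  · intro c v hv
    rcases List.mem_append.1 hv with hv | hv
    · exact h.returned c v hv
    · simp at hv
  · intro q hq
    -- Both functions begin with a register operation, so a process that executes a computation
    -- already has a running call.
    have hq' : C.ctl q ≠ none := by
      by_cases hqp : q = p
      · subst hqp
        intro hnone
        rw [Implementation.cur, hnone] at hi
        cases hw : w q (C.done q) <;> simp [hw, casInstr] at hi
      · simpa only [Function.update_of_ne hqp] using hq
    obtain ⟨j, hj⟩ := h.running q hq'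
    exact ⟨j, hj.append _⟩

theorem HistoryInv.step_ret {x : Val} {w : Fin n → ℕ → CASOp Val}
    {C : (casAlgorithm n Val).Config} {E : List (Event n (CASRet Val))}
    {st : Fin n → Option (CASRet Val)} {H : List (Effect n (CASRet Val))}
    (h : HistoryInv x w C E st H) {p : Fin n} {v : CASRet Val} {c : ℕ}
    (hi : casInstr n Val p ((casAlgorithm n Val).cur w C p) = .ret v c) :
    HistoryInv x w ((casAlgorithm n Val).step w C p).1
      (E ++ [((casAlgorithm n Val).step w C p).2]) (Function.update st p none) H := by
  have hst := Implementation.step_ret (I := casAlgorithm n Val) hi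
  rw [hst]
  have hcur := Implementation.cur_ret (I := casAlgorithm n Val) (w := w) (C := C) (p := p) c
  obtain ⟨hv, hinv⟩ := h.inv.ret_step hi
  have hdone : ∀ q, C.done q ≤ Function.update C.done p (C.done p + 1) q := by
    intro q
    by_cases hq : q = p
    · subst hq; simp
    · simp [hq]
  constructor
  · have := hinv (w p (C.done p + 1))
    rw [hcur]
    convert this using 1
    funext q
    by_cases hq : q = p
    · subst hq; simp
    · simp [hq]
  · exact h.runs
  · exact h.nodup
  · exact h.sorted
  · intro t ht
    obtain ⟨j, hj, hj'⟩ := h.started t ht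
    exact ⟨j, hj, hj'.append _⟩
  · intro t ht
    rw [List.length_append]
    exact Nat.lt_add_right _ (h.time_lt t ht)
  · intro t ht
    rw [hcur]
    rcases h.ended t ht with ⟨j, hj, hj'⟩ | ⟨h1, h2⟩
    · exact .inl ⟨j, hj, hj'.append _⟩
    -- The returning call is not late, so it already has a register operation at or after its
    -- effect.
    · have hp : t.call.1 ≠ p := by
        intro hp
        rw [hp] at h2
        exact CASLine.not_isLate_of_ret hi h2
      simp only [Function.update_of_ne hp]
      exact .inr ⟨h1, h2⟩
  · intro t ht
    rcases h.effective t ht with h1 | ⟨h1, h2⟩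
    · exact .inl (h1.trans_le (hdone _))
    · by_cases hp : t.call.1 = p
      · refine .inl ?_
        rw [h1, hp]
        simp
      · simp only [Function.update_of_ne hp]
        exact .inr ⟨h1, h2⟩
  · intro q u hu
    have hq : q ≠ p := by
      rintro rfl
      simp at hu
    simp only [Function.update_of_ne hq] at hu ⊢
    exact h.current q u hu
  · intro d u hu
    rcases List.mem_append.1 hu with hu | hu
    · obtain ⟨h1, h2⟩ := h.returned d u hu
      exact ⟨h1, h2.trans_le (hdone _)⟩
    · simp only [List.mem_singleton, Event.mk.injEq, StepKind.ret.injEq] at hu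
      obtain ⟨rfl, rfl⟩ := hu
      exact ⟨h.current p u hv, by simp⟩
  · intro q hq
    have hqp : q ≠ p := by
      rintro rfl
      simp at hq
    simp only [Function.update_of_ne hqp] at hq ⊢
    obtain ⟨j, hj⟩ := h.running q hq
    exact ⟨j, hj.append _⟩

theorem HistoryInv.exists_run {x : Val} {m : (casAlgorithm n Val).Memory}
    (hm : (casAlgorithm n Val).IsInit x m) (w : Fin n → ℕ → CASOp Val) (σ : List (Fin n)) :
    ∃ st H, HistoryInv x w ((casAlgorithm n Val).run w ((casAlgorithm n Val).initial m) σ)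
      ((casAlgorithm n Val).exec w ((casAlgorithm n Val).initial m) σ) st H := by
  induction σ using List.reverseRecOn with
  | nil => exact ⟨_, _, HistoryInv.initial hm w⟩
  | append_singleton σ p ih =>
    obtain ⟨st, H, h⟩ := ih
    rw [Implementation.exec_concat, Implementation.run_concat]
    cases hi : casInstr n Val p ((casAlgorithm n Val).cur w
        ((casAlgorithm n Val).run w ((casAlgorithm n Val).initial m) σ) p) with
    | regOp r o k => exact h.step_regOp hi
    | compute k => exact ⟨_, _, h.step_compute hi⟩
    | ret v c => exact ⟨_, _, h.step_ret hi⟩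

theorem casAlgorithm_linearizable (n : ℕ) (Val : Type) [DecidableEq Val] :
    (casAlgorithm n Val).Linearizable (casObject Val) := by
  intro x m hm w σ
  obtain ⟨st, H, h⟩ := HistoryInv.exists_run hm w σ
  refine isLinearization_of_effects h.runs h.nodup h.sorted h.started ?_
    fun c v hv => (h.returned c v hv).1
  rintro t ht ⟨v, hv⟩
  -- A late call is still running, whereas the index of a returned call is below `done`.
  refine (h.ended t ht).resolve_right fun hh => ?_
  have := (h.returned _ _ hv).2
  omega

end Linearization

/-! ### The registers -/

/-- The registers are `V` and `P`, and two for each process. -/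
def casRegEquiv (n : ℕ) : CASReg n ≃ Bool ⊕ Fin n ⊕ Fin n where
  toFun
    | .V => .inl false
    | .P => .inl true
    | .A i => .inr (.inl i)
    | .R i => .inr (.inr i)
  invFun
    | .inl false => .V
    | .inl true => .P
    | .inr (.inl i) => .A i
    | .inr (.inr i) => .R i
  left_inv r := by cases r <;> rfl
  right_inv r := by rcases r with (_ | _) | _ | _ <;> rfl

/-- Ensures that the statements about all admissible initial contents are not vacuous. Positivity of
`n` supplies a process name to store in `P`. -/
theorem casAlgorithm_exists_isInit {n : ℕ} (hn : 0 < n) {Val : Type} [DecidableEq Val] (x : Val) :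
    ∃ m, (casAlgorithm n Val).IsInit x m := by
  refine ⟨fun r => match r with
    | .V => (0, x)
    | .P => (0, (⟨0, hn⟩, 0))
    | .A _ => (0, x)
    | .R _ => (0, false), rfl, rfl⟩

theorem mainTheorem1 :
    ∃ K C : ℕ, ∀ (Val : Type) [DecidableEq Val] (n : ℕ), 0 < n →
      (∀ x : Val, ∃ m, (casAlgorithm n Val).IsInit x m) ∧
      (casAlgorithm n Val).WaitFree ∧
      (casAlgorithm n Val).Linearizable (casObject Val) ∧
      (casAlgorithm n Val).StepBound K ∧
      Finite (casAlgorithm n Val).Reg ∧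
      Nat.card (casAlgorithm n Val).Reg ≤ C * n := by
  -- There are `2 + 2 * n` registers, and this is at most `4 * n` because `1 ≤ n`.
  refine ⟨15, 4, fun Val _ n hn => ⟨casAlgorithm_exists_isInit hn, (CASLine.isRank n Val).waitFree,
    casAlgorithm_linearizable n Val, (CASLine.isRank n Val).stepBound,
    Finite.of_equiv _ (casRegEquiv n).symm, ?_⟩⟩
  rw [Nat.card_congr (casRegEquiv n)]
  simp only [Nat.card_eq_fintype_card, Fintype.card_sum, Fintype.card_bool, Fintype.card_fin]
  omega
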